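/- Let $G$ be a finite unweighted graph, directed or undirected, with vertex set $V\cup\{s,t\}$, where $s\neq t$ are two distinguished vertices outside $V$, and with edge set $E$ (parallel edges are allowed). The *edge path coalitional game* (EPCG) of $G$ has player set $N=E$, and a coalition $C\subseteq E$ has value $v(C)=1$ if there is an $s$-$t$ path all of whose edges lie in $C$, and $v(C)=0$ otherwise. If no edge leads from $s$ to $t$, the *vertex path coalitional game* (VPCG) of $G$ has player set $N=V$, and a coalition $C\subseteq V$ has value $v(C)=1$ if there is an $s$-$t$ path all of whose vertices other than $s$ and $t$ lie in $C$, and $v(C)=0$ otherwise. A *coalition structure* is a partition $\pi$ of $N$ into nonempty coalitions; its social welfare is $v(\pi)=\sum_{C\in\pi}v(C)$, and $\pi$ is *optimal* if $v(\pi)\ge v(\pi')$ for every coalition structure $\pi'$. The problem OptCS for a class of games is to compute, from the representation of a game in the class, an optimal coalition structure of that game. **Proposition.** OptCS can be solved in polynomial time for EPCGs and for VPCGs: for each of these two classes there is an algorithm which, given the graph $G$ (by its vertices and a list of its edges), computes an optimal coalition structure of the game in a number of steps that is at most a fixed polynomial in $|V|+|E|$. (Steps are those of a random access machine whose arithmetic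 is addition and subtraction of natural numbers; this notion of polynomial time is the same as that for Turing machines.) -/

import Mathlib

namespace OptCS

/-! ### Coalitional games and coalition structures -/

/-- A coalitional game on the player set `{0, …, n-1}`. -/
structure CoalitionalGame (n : ℕ) where
  /-- the characteristic function -/
  v : Finset (Fin n) → ℝ
  v_empty : v ∅ = 0

/-- A coalition structure: a partition of the player set (into nonempty coalitions). -/
abbrev CoalitionStructure (n : ℕ) : Type := Finpartition (Finset.univ : Finset (Fin n))

/-- The social welfare attained by a coalition structure. -/
def CoalitionalGame.welfare {n : ℕ} (g : CoalitionalGame n) (π : CoalitionStructure n) : ℝ :=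
  ∑ C ∈ π.parts, g.v C

def CoalitionalGame.IsOptimal {n : ℕ} (g : CoalitionalGame n) (π : CoalitionStructure n) : Prop :=
  ∀ π' : CoalitionStructure n, g.welfare π' ≤ g.welfare π

/-! ### Graphs with two terminals, and their path coalitional games -/

/-- The vertex set `V ∪ {s, t}`, where `V = {0, …, k-1}` and `s ≠ t` lie outside `V`. -/
inductive Vertex (k : ℕ) : Type
  | s : Vertex k
  | t : Vertex k
  | inner (x : Fin k) : Vertex k

/-- A finite directed or undirected unweighted graph on `V ∪ {s, t}`, with `V = {0, …, numV-1}`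
and `E = {0, …, numE-1}`. Loops and parallel edges are permitted, not required. In the undirected
case the order of the two ends `src e`, `tgt e` of an edge `e` is irrelevant. -/
structure STGraph where
  directed : Bool
  numV : ℕ
  numE : ℕ
  src : Fin numE → Vertex numV
  tgt : Fin numE → Vertex numV

namespace STGraph

/-- The edge `e` can be traversed from `x` to `y`. -/
def Joins (G : STGraph) (e : Fin G.numE) (x y : Vertex G.numV) : Prop :=
  (G.src e = x ∧ G.tgt e = y) ∨ (G.directed = false ∧ G.src e = y ∧ G.tgt e = x)

/-- `p` lists, in order, the vertices of an `s`-`t` path all of whose edges belong to `C`. -/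
structure IsSTPath (G : STGraph) (C : Finset (Fin G.numE)) (p : List (Vertex G.numV)) : Prop where
  head : p.head? = some Vertex.s
  last : p.getLast? = some Vertex.t
  nodup : p.Nodup
  chain : p.IsChain (fun x y => ∃ e ∈ C, G.Joins e x y)

/-- The set of edges `C` admits an `s`-`t` path. -/
def EdgesAdmitPath (G : STGraph) (C : Finset (Fin G.numE)) : Prop :=
  ∃ p, G.IsSTPath C p

/-- The set of vertices `C ⊆ V` admits an `s`-`t` path: there is one whose vertices other than
`s` and `t` all belong to `C`. -/
def VerticesAdmitPath (G : STGraph) (C : Finset (Fin G.numV)) : Prop :=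
  ∃ p, G.IsSTPath Finset.univ p ∧ ∀ x, Vertex.inner x ∈ p → x ∈ C

/-- No edge leads from `s` to `t`; equivalently, the empty set of vertices admits no path. -/
def NoDirectEdge (G : STGraph) : Prop :=
  ∀ e, ¬ G.Joins e Vertex.s Vertex.t

theorem not_edgesAdmitPath_empty (G : STGraph) : ¬ G.EdgesAdmitPath ∅ := by
  rintro ⟨p, hp⟩
  rcases p with _ | ⟨a, _ | ⟨b, l⟩⟩
  · simpa using hp.head
  · have h1 := hp.head
    have h2 := hp.last
    simp_all
  · have h3 := hp.chain
    simp at h3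

theorem not_verticesAdmitPath_empty (G : STGraph) (h : G.NoDirectEdge) :
    ¬ G.VerticesAdmitPath ∅ := by
  rintro ⟨p, hp, hC⟩
  rcases p with _ | ⟨a, _ | ⟨b, l⟩⟩
  · simpa using hp.head
  · have h1 := hp.head
    have h2 := hp.last
    simp_all
  · have h1 := hp.head
    have h3 := hp.chain
    have h4 := hp.nodup
    simp only [List.head?_cons, Option.some.injEq] at h1
    subst h1
    rw [List.isChain_cons_cons] at h3
    obtain ⟨⟨e, -, he⟩, -⟩ := h3
    cases b with
    | s => simp at h4
    | t => exact h e he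
    | inner x => simpa using hC x (by simp)

open Classical in
/-- The edge path coalitional game of `G`: the players are the edges. -/
noncomputable def edgePathGame (G : STGraph) : CoalitionalGame G.numE where
  v C := if G.EdgesAdmitPath C then 1 else 0
  v_empty := if_neg G.not_edgesAdmitPath_empty

open Classical in
/-- The vertex path coalitional game of `G`: the players are the vertices other than `s`, `t`. -/
noncomputable def vertexPathGame (G : STGraph) (h : G.NoDirectEdge) : CoalitionalGame G.numV where
  v C := if G.VerticesAdmitPath C then 1 else 0
  v_empty := if_neg (G.not_verticesAdmitPath_empty h)

end STGraph

/-! ### Random access machines -/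

/-- The memory of a random access machine: registers, and arrays of unbounded length, all holding
natural numbers. A program names its registers and arrays by constants, so it uses only finitely
many of each; the cells of an array are addressed through the contents of a register. -/
structure State where
  reg : ℕ → ℕ
  arr : ℕ → ℕ → ℕ

def State.setReg (σ : State) (x n : ℕ) : State :=
  { σ with reg := Function.update σ.reg x n }

def State.setArr (σ : State) (a i n : ℕ) : State :=
  { σ with arr := Function.update σ.arr a (Function.update (σ.arr a) i n) }

/-- Random access programs. The only arithmetic is addition and truncated subtraction, so that
`T` steps lengthen the numbers that occur by at most `T` bits, and counting each instruction
as one step agrees with Turing machine time up to a polynomial. -/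
inductive Program : Type
  /-- `x := c` -/
  | const (x c : ℕ) : Program
  /-- `x := y + z` -/
  | add (x y z : ℕ) : Program
  /-- `x := y - z` (and `x := 0` if `y < z`) -/
  | sub (x y z : ℕ) : Program
  /-- `x := a[y]` -/
  | load (x a y : ℕ) : Program
  /-- `a[x] := y` -/
  | store (a x y : ℕ) : Program
  /-- `P; Q` -/
  | seq (P Q : Program) : Program
  /-- if `x ≠ 0` then `P` else `Q` -/
  | cond (x : ℕ) (P Q : Program) : Program
  /-- while `x ≠ 0` do `P` -/
  | loop (x : ℕ) (P : Program) : Program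

/-- `Exec P σ σ' T`: started in `σ`, the program `P` halts in `σ'` after exactly `T` steps, each
elementary instruction and each test counting as one step. -/
inductive Exec : Program → State → State → ℕ → Prop
  | const (σ : State) (x c : ℕ) : Exec (.const x c) σ (σ.setReg x c) 1
  | add (σ : State) (x y z : ℕ) : Exec (.add x y z) σ (σ.setReg x (σ.reg y + σ.reg z)) 1
  | sub (σ : State) (x y z : ℕ) : Exec (.sub x y z) σ (σ.setReg x (σ.reg y - σ.reg z)) 1
  | load (σ : State) (x a y : ℕ) : Exec (.load x a y) σ (σ.setReg x (σ.arr a (σ.reg y))) 1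
  | store (σ : State) (a x y : ℕ) :
      Exec (.store a x y) σ (σ.setArr a (σ.reg x) (σ.reg y)) 1
  | seq {P Q : Program} {σ σ₁ σ₂ : State} {T₁ T₂ : ℕ} :
      Exec P σ σ₁ T₁ → Exec Q σ₁ σ₂ T₂ → Exec (.seq P Q) σ σ₂ (T₁ + T₂)
  | cond_true {x : ℕ} {P Q : Program} {σ σ' : State} {T : ℕ} :
      σ.reg x ≠ 0 → Exec P σ σ' T → Exec (.cond x P Q) σ σ' (T + 1)
  | cond_false {x : ℕ} {P Q : Program} {σ σ' : State} {T : ℕ} :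
      σ.reg x = 0 → Exec Q σ σ' T → Exec (.cond x P Q) σ σ' (T + 1)
  | loop_stop {x : ℕ} {P : Program} {σ : State} :
      σ.reg x = 0 → Exec (.loop x P) σ σ 1
  | loop_step {x : ℕ} {P : Program} {σ σ₁ σ₂ : State} {T₁ T₂ : ℕ} :
      σ.reg x ≠ 0 → Exec P σ σ₁ T₁ → Exec (.loop x P) σ₁ σ₂ T₂ →
        Exec (.loop x P) σ σ₂ (T₁ + T₂ + 1)

/-- The initial memory on input `w`: `w` stands in array `0`, its length in register `0`, and
everything else is `0`. -/
def inputState (w : List ℕ) : State where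
  reg x := if x = 0 then w.length else 0
  arr a i := if a = 0 then w.getD i 0 else 0

/-- The output of a halted program: the first `n` entries of array `1`, where `n` is the content
of register `0`. -/
def State.output (σ : State) : List ℕ :=
  (List.range (σ.reg 0)).map (σ.arr 1)

/-! ### The problem `OptCS` and its polynomial-time solvability -/

/-- The list `w` describes the coalition structure `π`: it gives each player a label, and two
players have the same label exactly if they belong to the same coalition. -/
def Describes {n : ℕ} (w : List ℕ) (π : CoalitionStructure n) : Prop :=
  w.length = n ∧
    ∀ i j : Fin n, w.getD i 0 = w.getD j 0 ↔ ∃ C ∈ π.parts, i ∈ C ∧ j ∈ C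

/-- `OptCS` is solvable in polynomial time for the games `game I`, where `encode I` is the input
that represents `game I` and `size I` is its size: one program computes, from every input
`encode I`, an optimal coalition structure of `game I`, in time polynomial in `size I`. -/
def OptCSInPolyTime {Inst : Type} (encode : Inst → List ℕ) (size : Inst → ℕ) (n : Inst → ℕ)
    (game : (I : Inst) → CoalitionalGame (n I)) : Prop :=
  ∃ (P : Program) (p : Polynomial ℕ), ∀ I : Inst, ∃ (σ : State) (T : ℕ),
    Exec P (inputState (encode I)) σ T ∧ T ≤ p.eval (size I) ∧
      ∃ π : CoalitionStructure (n I), (game I).IsOptimal π ∧ Describes σ.output π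

/-- The number of a vertex in the input. -/
def Vertex.code {k : ℕ} : Vertex k → ℕ
  | .s => 0
  | .t => 1
  | .inner x => x + 2

/-- The input that represents a graph: the kind of graph, the numbers of vertices (other than
`s`, `t`) and of edges, and then the list of the edges, each given by its two ends. -/
def STGraph.encode (G : STGraph) : List ℕ :=
  [if G.directed then 1 else 0, G.numV, G.numE] ++
    (List.ofFn fun e => [(G.src e).code, (G.tgt e).code]).flatten

/-- The size of a graph: the number of vertices (other than `s`, `t`) plus that of edges. -/
def STGraph.size (G : STGraph) : ℕ := G.numV + G.numE

end OptCS

/-!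
In both games the social welfare of a coalition structure is the number of its winning coalitions,
so an optimal structure is a largest family of disjoint paths. The proof is Menger's theorem in its
algorithmic form, together with a program for it.

Both games are brought into one form (`IsNetwork`, `IsGameOf`): the players are vertices of a
digraph with two terminals, and a coalition wins if it contains a walk between the terminals. For
the vertex path game this is the graph itself, for the edge path game it is its line graph
(`STGraph.winning_vertexArc_iff`, `STGraph.winning_edgeArc_iff`).

A family of `k` disjoint paths is encoded as a permutation `p` of the players and `k` copies of the
terminals, where `x ↦ p x` has to follow the arcs and players off the paths follow loops
(`PathSystem`). The algorithm adds a further copy `d` with `p d = d`, which is not an arc, and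
looks for an alternating walk that repairs this: it visits the heads of the arcs from all `a` whose
`p a` has been visited. If `1` is visited, multiplying `p` with transpositions along the parent
pointers of the search moves the defect `d ↦ p d` back to the start of the search, where it vanishes
(`Augmenting.step`, `Augmenting.pathSystem`). Otherwise let `V` be the set of visited vertices.
The players in `V \ p⁻¹ V` meet every winning coalition, and since `V` and `p⁻¹ V` have the same
size there are as many of them as there are elements of `p⁻¹ V \ V`, all of which are copies
of the terminals. Hence no coalition structure has more than `k` winning coalitions
(`PathSystem.welfare_le`). There are at most as many phases as players.

Programs are verified in a Hoare logic for total correctness with time bounds (`Runs`), whose loop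
rules are `Runs.loop` and `Runs.countdown`. Invariants mention only what a loop changes; the rest
follows from the syntactic `Frame` condition.
-/

namespace OptCS

/-! ### A program logic for random access programs -/

@[simp] theorem State.setReg_reg (σ : State) (x n y : ℕ) :
    (σ.setReg x n).reg y = if y = x then n else σ.reg y := by
  simp [State.setReg, Function.update_apply]

@[simp] theorem State.setReg_arr (σ : State) (x n : ℕ) : (σ.setReg x n).arr = σ.arr := rfl

@[simp] theorem State.setArr_reg (σ : State) (a i n : ℕ) : (σ.setArr a i n).reg = σ.reg := rfl

@[simp] theorem State.setArr_arr (σ : State) (a i n b : ℕ) :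
    (σ.setArr a i n).arr b = if b = a then Function.update (σ.arr a) i n else σ.arr b := by
  simp [State.setArr, Function.update_apply]

namespace Program

/-- Whether some instruction of the program assigns to the register `r`. -/
def writesReg : Program → ℕ → Bool
  | const x _, r => r == x
  | add x _ _, r => r == x
  | sub x _ _, r => r == x
  | load x _ _, r => r == x
  | store _ _ _, _ => false
  | seq P Q, r => P.writesReg r || Q.writesReg r
  | cond _ P Q, r => P.writesReg r || Q.writesReg r
  | loop _ P, r => P.writesReg r

/-- Whether some instruction of the program stores into the array `b`. -/
def writesArr : Program → ℕ → Bool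
  | store a _ _, b => b == a
  | seq P Q, b => P.writesArr b || Q.writesArr b
  | cond _ P Q, b => P.writesArr b || Q.writesArr b
  | loop _ P, b => P.writesArr b
  | _, _ => false

/-- The program contains no loop. -/
def loopFree : Program → Bool
  | seq P Q => P.loopFree && Q.loopFree
  | cond _ P Q => P.loopFree && Q.loopFree
  | loop _ _ => false
  | _ => true

/-- A bound for the number of steps of a loop-free program. (The value for a loop is junk.) -/
def steps : Program → ℕ
  | seq P Q => P.steps + Q.steps
  | cond _ P Q => max P.steps Q.steps + 1
  | _ => 1

/-- The state transformation effected by a loop-free program. (A loop is treated as doing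
nothing.) -/
def sem : Program → State → State
  | const x c, σ => σ.setReg x c
  | add x y z, σ => σ.setReg x (σ.reg y + σ.reg z)
  | sub x y z, σ => σ.setReg x (σ.reg y - σ.reg z)
  | load x a y, σ => σ.setReg x (σ.arr a (σ.reg y))
  | store a x y, σ => σ.setArr a (σ.reg x) (σ.reg y)
  | seq P Q, σ => Q.sem (P.sem σ)
  | cond x P Q, σ => if σ.reg x = 0 then Q.sem σ else P.sem σ
  | loop _ _, σ => σ

/-- Run `P` for the values `m - 1, …, 0` of the register `x`, where `m` is its initial content;
the register `1` has to contain `1`. -/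
def countdown (x : ℕ) (P : Program) : Program :=
  .loop x (.seq (.sub x x 1) P)

/-- `x := y` -/
def copy (x y : ℕ) : Program := .seq (.const x 0) (.add x x y)

/-- Sequential composition. -/
infixr:60 " ;; " => Program.seq

end Program

open Program

/-- `σ'` agrees with `σ` on everything that `P` does not write to. -/
def Frame (P : Program) (σ σ' : State) : Prop :=
  (∀ x, P.writesReg x = false → σ'.reg x = σ.reg x) ∧
    ∀ a, P.writesArr a = false → σ'.arr a = σ.arr a

theorem Frame.refl (P : Program) (σ : State) : Frame P σ σ := ⟨fun _ _ => rfl, fun _ _ => rfl⟩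

theorem Frame.trans {P : Program} {σ₁ σ₂ σ₃ : State} (h : Frame P σ₁ σ₂) (h' : Frame P σ₂ σ₃) :
    Frame P σ₁ σ₃ :=
  ⟨fun x hx => (h'.1 x hx).trans (h.1 x hx), fun a ha => (h'.2 a ha).trans (h.2 a ha)⟩

theorem Frame.mono {P Q : Program} {σ σ' : State} (h : Frame P σ σ')
    (hr : ∀ x, Q.writesReg x = false → P.writesReg x = false)
    (ha : ∀ a, Q.writesArr a = false → P.writesArr a = false) : Frame Q σ σ' :=
  ⟨fun x hx => h.1 x (hr x hx), fun a hx => h.2 a (ha a hx)⟩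

theorem Exec.frame {P : Program} {σ σ' : State} {T : ℕ} (h : Exec P σ σ' T) : Frame P σ σ' := by
  induction h with
  | const | add | sub | load =>
    exact ⟨fun r hr => by simp_all [writesReg], fun _ _ => rfl⟩
  | store => exact ⟨fun _ _ => rfl, fun b hb => by simp_all [writesArr]⟩
  | seq _ _ h₁ h₂ =>
    exact (h₁.mono (by simp_all [writesReg]) (by simp_all [writesArr])).trans
      (h₂.mono (by simp_all [writesReg]) (by simp_all [writesArr]))
  | cond_true _ _ h => exact h.mono (by simp_all [writesReg]) (by simp_all [writesArr])
  | cond_false _ _ h => exact h.mono (by simp_all [writesReg]) (by simp_all [writesArr])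
  | loop_stop => exact .refl _ _
  | loop_step _ _ _ h₁ h₂ =>
    exact (h₁.mono (by simp [writesReg]) (by simp [writesArr])).trans h₂

theorem Frame.setReg (σ : State) (x n : ℕ) : Frame (.const x n) σ (σ.setReg x n) :=
  (Exec.const σ x n).frame

/-- Total correctness with a time bound: started in `σ`, the program `P` halts after at most `B`
steps in a state that satisfies `Q`. -/
def Runs (P : Program) (B : ℕ) (Q : State → Prop) (σ : State) : Prop :=
  ∃ σ' T, Exec P σ σ' T ∧ T ≤ B ∧ Q σ'

namespace Runs

variable {P P' : Program} {B B' : ℕ} {Q Q' : State → Prop} {σ : State}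

theorem mono (h : Runs P B Q σ) (hB : B ≤ B') (hQ : ∀ σ', Q σ' → Q' σ') : Runs P B' Q' σ := by
  obtain ⟨σ', T, h₁, h₂, h₃⟩ := h
  exact ⟨σ', T, h₁, h₂.trans hB, hQ _ h₃⟩

theorem frame (h : Runs P B Q σ) : Runs P B (fun σ' => Q σ' ∧ Frame P σ σ') σ := by
  obtain ⟨σ', T, h₁, h₂, h₃⟩ := h
  exact ⟨σ', T, h₁, h₂, h₃, h₁.frame⟩

theorem seq (h : Runs P B (fun σ' => Runs P' B' Q σ') σ) : Runs (P ;; P') (B + B') Q σ := by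
  obtain ⟨σ₁, T₁, h₁, hT₁, σ₂, T₂, h₂, hT₂, hQ⟩ := h
  exact ⟨σ₂, _, .seq h₁ h₂, by omega, hQ⟩

/-- Sequential composition where the specification `Q'` of the first part is combined with the
fact that it changes only what it writes to. -/
theorem seq_frame (h : Runs P B Q' σ)
    (h' : ∀ σ', Q' σ' → Frame P σ σ' → Runs P' B' Q σ') : Runs (P ;; P') (B + B') Q σ :=
  seq (h.frame.mono le_rfl fun σ' hσ => h' σ' hσ.1 hσ.2)

theorem exec_sem (P : Program) (hP : P.loopFree) (σ : State) :
    ∃ T ≤ P.steps, Exec P σ (P.sem σ) T := by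
  induction P generalizing σ with
  | const => exact ⟨1, le_rfl, .const ..⟩
  | add => exact ⟨1, le_rfl, .add ..⟩
  | sub => exact ⟨1, le_rfl, .sub ..⟩
  | load => exact ⟨1, le_rfl, .load ..⟩
  | store => exact ⟨1, le_rfl, .store ..⟩
  | loop => simp [loopFree] at hP
  | seq P Q ihP ihQ =>
    simp only [loopFree, Bool.and_eq_true] at hP
    obtain ⟨T₁, hT₁, h₁⟩ := ihP hP.1 σ
    obtain ⟨T₂, hT₂, h₂⟩ := ihQ hP.2 (P.sem σ)
    exact ⟨T₁ + T₂, by simp only [steps]; omega, .seq h₁ h₂⟩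
  | cond x P Q ihP ihQ =>
    simp only [loopFree, Bool.and_eq_true] at hP
    by_cases hx : σ.reg x = 0
    · obtain ⟨T, hT, h⟩ := ihQ hP.2 σ
      exact ⟨T + 1, by simp only [steps]; omega, by simpa [sem, hx] using h.cond_false hx⟩
    · obtain ⟨T, hT, h⟩ := ihP hP.1 σ
      exact ⟨T + 1, by simp only [steps]; omega, by simpa [sem, hx] using h.cond_true hx⟩

theorem of_sem (hP : P.loopFree = true) (hB : P.steps ≤ B) (h : Q (P.sem σ)) : Runs P B Q σ := by
  obtain ⟨T, hT, hE⟩ := exec_sem P hP σ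
  exact ⟨_, T, hE, hT.trans hB, h⟩

theorem _root_.OptCS.Frame.sem (hP : P.loopFree = true) (σ : State) : Frame P σ (P.sem σ) := by
  obtain ⟨_, _, h⟩ := exec_sem P hP σ
  exact h.frame

/-- A loop-free program followed by another one. -/
theorem sem_seq (hP : P.loopFree = true) (hB : P.steps ≤ B) (h : Runs P' B' Q (P.sem σ)) :
    Runs (P ;; P') (B + B') Q σ :=
  seq (of_sem hP hB h)

theorem cond {x : ℕ} (h : σ.reg x ≠ 0 → Runs P B Q σ) (h' : σ.reg x = 0 → Runs P' B Q σ) :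
    Runs (.cond x P P') (B + 1) Q σ := by
  by_cases hx : σ.reg x = 0
  · obtain ⟨σ', T, h₁, h₂, h₃⟩ := h' hx
    exact ⟨σ', T + 1, .cond_false hx h₁, by omega, h₃⟩
  · obtain ⟨σ', T, h₁, h₂, h₃⟩ := h hx
    exact ⟨σ', T + 1, .cond_true hx h₁, by omega, h₃⟩

/-- The rule for loops: the invariant `I v` carries a variant `v` that decreases. -/
theorem loop {x : ℕ} {I : ℕ → State → Prop} {v : ℕ} (hσ : I v σ)
    (hI : ∀ v σ', I v σ' → Frame P σ σ' → σ'.reg x ≠ 0 →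
      Runs P B (fun σ'' => ∃ v' < v, I v' σ'') σ') :
    Runs (.loop x P) (v * (B + 1) + 1) (fun σ' => (∃ v, I v σ') ∧ σ'.reg x = 0) σ := by
  suffices h : ∀ v σ', I v σ' → Frame P σ σ' → Runs (.loop x P) (v * (B + 1) + 1)
      (fun σ' => (∃ v, I v σ') ∧ σ'.reg x = 0) σ' from h v σ hσ (.refl _ _)
  intro v
  induction v using Nat.strong_induction_on with
  | _ v ih =>
    intro σ' h hF
    by_cases hx : σ'.reg x = 0
    · exact ⟨σ', 1, Exec.loop_stop hx, by omega, ⟨v, h⟩, hx⟩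
    · obtain ⟨σ₁, T₁, h₁, hT₁, v', hv', hI₁⟩ := hI v σ' h hF hx
      obtain ⟨σ₂, T₂, h₂, hT₂, hQ⟩ := ih v' hv' σ₁ hI₁ (hF.trans h₁.frame)
      refine ⟨σ₂, _, .loop_step hx h₁ h₂, ?_, hQ⟩
      have : (v' + 1) * (B + 1) ≤ v * (B + 1) := Nat.mul_le_mul_right _ hv'
      rw [Nat.add_mul] at this
      omega

/-- The rule for bounded loops: `I i` holds when `i` rounds are left. -/
theorem countdown {x m : ℕ} {I : ℕ → State → Prop} (h₁ : σ.reg 1 = 1)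
    (hm : σ.reg x = m) (hσ : I m σ) (hx : P.writesReg x = false)
    (hP : (Program.countdown x P).writesReg 1 = false)
    (hI : ∀ i < m, ∀ σ', Frame (Program.countdown x P) σ σ' → σ'.reg x = i + 1 → I (i + 1) σ' →
      Runs P B (I i) (σ'.setReg x i)) :
    Runs (Program.countdown x P) (m * (B + 2) + 1) (I 0) σ := by
  have key := loop (P := .seq (.sub x x 1) P) (B := B + 1) (x := x)
    (I := fun v σ' => I v σ' ∧ σ'.reg x = v ∧ v ≤ m) (σ := σ) (v := m) ⟨hσ, hm, le_rfl⟩ ?_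
  · refine key.mono (by rw [Nat.add_assoc]) ?_
    rintro σ' ⟨⟨v, hv, hv', -⟩, h0⟩
    obtain rfl : v = 0 := hv'.symm.trans h0
    exact hv
  · rintro v σ' ⟨hv, hxv, hvm⟩ hF h0
    obtain ⟨i, rfl⟩ : ∃ i, v = i + 1 := ⟨v - 1, by omega⟩
    have h1 : σ'.reg 1 = 1 := (hF.1 1 hP).trans h₁
    rw [Nat.add_comm B 1]
    refine seq ⟨_, _, .sub σ' x x 1, le_rfl, ?_⟩
    rw [hxv, h1, Nat.add_sub_cancel]
    refine (hI i hvm σ' ⟨fun r hr => hF.1 r hr, fun a ha => hF.2 a ha⟩ hxv hv).frame.mono le_rfl ?_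
    rintro σ'' ⟨hi, hF'⟩
    exact ⟨i, Nat.lt_succ_self i, hi, by rw [hF'.1 x hx]; simp, by omega⟩

end Runs

/-! ### Networks, winning coalitions and cuts -/

/-- The standard form to which both games are reduced: a digraph on `{0, …, n+1}`, where `0` and `1`
are the terminals `s` and `t` and `i + 2` is the player `i`. Players carry loops, and no arc leads
from `0` to `1`. -/
structure IsNetwork (n : ℕ) (Arc : ℕ → ℕ → Prop) : Prop where
  left_lt : ∀ {a b}, Arc a b → a < n + 2
  right_lt : ∀ {a b}, Arc a b → b < n + 2
  self : ∀ {x}, 2 ≤ x → x < n + 2 → Arc x x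
  not_direct : ¬ Arc 0 1

section Winning

variable {n : ℕ} {Arc : ℕ → ℕ → Prop}

/-- The player `x` is the end of a walk from `0` through players in `C`. -/
inductive Reach (Arc : ℕ → ℕ → Prop) (C : Finset (Fin n)) : Fin n → Prop
  | first {x : Fin n} : x ∈ C → Arc 0 (x + 2) → Reach Arc C x
  | next {x y : Fin n} : Reach Arc C x → y ∈ C → Arc (x + 2) (y + 2) → Reach Arc C y

/-- There is a walk from `0` to `1` through at least one player, all of them in `C`. -/
def Winning (Arc : ℕ → ℕ → Prop) (C : Finset (Fin n)) : Prop :=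
  ∃ x, Reach Arc C x ∧ Arc (x + 2) 1

theorem Reach.mem {C : Finset (Fin n)} {x : Fin n} (h : Reach Arc C x) : x ∈ C := by
  cases h <;> assumption

theorem Reach.mono {C C' : Finset (Fin n)} (hC : C ⊆ C') {x : Fin n} (h : Reach Arc C x) :
    Reach Arc C' x := by
  induction h with
  | first h h' => exact .first (hC h) h'
  | next _ h h' ih => exact .next ih (hC h) h'

theorem Winning.mono {C C' : Finset (Fin n)} (hC : C ⊆ C') (h : Winning Arc C) :
    Winning Arc C' :=
  h.imp fun _ h => ⟨h.1.mono hC, h.2⟩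

open Classical in
/-- `g` is the simple game whose winning coalitions are those joining `0` to `1`. -/
def IsGameOf (g : CoalitionalGame n) (Arc : ℕ → ℕ → Prop) : Prop :=
  ∀ C, g.v C = if Winning Arc C then 1 else 0

open Classical in
theorem IsGameOf.welfare_eq {g : CoalitionalGame n} (hg : IsGameOf g Arc)
    (π : CoalitionStructure n) : g.welfare π = (π.parts.filter (Winning Arc)).card := by
  simp [CoalitionalGame.welfare, hg _, Finset.sum_boole]

/-- Weak duality: if every winning coalition meets `K`, then `|K|` bounds the social welfare. -/
theorem IsGameOf.welfare_le_card {g : CoalitionalGame n} (hg : IsGameOf g Arc) (K : Finset (Fin n))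
    (hK : ∀ C, Winning Arc C → ∃ x ∈ C, x ∈ K) (π : CoalitionStructure n) :
    g.welfare π ≤ K.card := by
  classical
  rw [hg.welfare_eq]
  norm_cast
  refine Finset.card_le_card_of_forall_subsingleton (fun C x => x ∈ C) (fun C hC => ?_) ?_
  · obtain ⟨x, hx, hxK⟩ := hK C (Finset.mem_filter.1 hC).2
    exact ⟨x, hxK, hx⟩
  · rintro x - C ⟨hC, hx⟩ C' ⟨hC', hx'⟩
    exact π.disjoint.elim_finset (Finset.mem_filter.1 hC).1 (Finset.mem_filter.1 hC').1 x hx hx'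

/-- A labelling with winning label classes, as many as the social welfare can possibly be,
describes an optimal coalition structure. -/
theorem IsGameOf.exists_isOptimal_describes {g : CoalitionalGame n} (hg : IsGameOf g Arc)
    (w : List ℕ) (hw : w.length = n) (Q : Finset ℕ) (hub : ∀ π, g.welfare π ≤ Q.card)
    (hQ : ∀ q ∈ Q, Winning Arc (Finset.univ.filter fun i : Fin n => w.getD i 0 = q)) :
    ∃ π : CoalitionStructure n, g.IsOptimal π ∧ Describes w π := by
  classical
  let π : CoalitionStructure n := Finpartition.ofSetoid (Setoid.ker fun i : Fin n => w.getD i 0)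
  have hrel : ∀ i j : Fin n, j ∈ π.part i ↔ w.getD i 0 = w.getD j 0 := fun i j =>
    Finpartition.mem_part_ofSetoid_iff_rel
  refine ⟨π, fun π' => (hub π').trans ?_, hw, fun i j => ?_⟩
  · rw [hg.welfare_eq]
    norm_cast
    refine Finset.card_le_card_of_injOn (fun q => Finset.univ.filter fun i : Fin n => w.getD i 0 = q)
      (fun q hq => ?_) ?_
    · obtain ⟨x, hx, -⟩ := hQ q hq
      have hx := (Finset.mem_filter.1 hx.mem).2
      refine Finset.mem_filter.2 ⟨?_, hQ q hq⟩
      convert π.part_mem.2 (Finset.mem_univ x) using 1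
      ext j
      rw [hrel, hx]
      simp [eq_comm]
    · intro q hq q' _ h
      obtain ⟨x, hx, -⟩ := hQ q hq
      have hx := hx.mem
      have hx' := hx
      simp only at h
      rw [h] at hx'
      exact (Finset.mem_filter.1 hx).2.symm.trans (Finset.mem_filter.1 hx').2
  · rw [← hrel]
    constructor
    · intro h
      exact ⟨π.part i, π.part_mem.2 (Finset.mem_univ i), π.mem_part (Finset.mem_univ i), h⟩
    · rintro ⟨C, hC, hi, hj⟩
      rwa [π.part_eq_of_mem hC hi]

end Winning

/-! ### Path systems as permutations -/

section PathSystem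

variable {n : ℕ} {Arc : ℕ → ℕ → Prop}

/-- The vertex that `x` stands for as a tail: the numbers from `n + 2` on stand for `0`. -/
def tailOf (n x : ℕ) : ℕ := if x < n + 2 then x else 0

/-- The vertex that `y` stands for as a head: the numbers from `n + 2` on stand for `1`. -/
def headOf (n y : ℕ) : ℕ := if y < n + 2 then y else 1

theorem tailOf_of_lt {x : ℕ} (h : x < n + 2) : tailOf n x = x := if_pos h
theorem tailOf_of_le {x : ℕ} (h : n + 2 ≤ x) : tailOf n x = 0 := if_neg (by omega)
theorem headOf_of_lt {x : ℕ} (h : x < n + 2) : headOf n x = x := if_pos h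
theorem headOf_of_le {x : ℕ} (h : n + 2 ≤ x) : headOf n x = 1 := if_neg (by omega)

/-- `p` encodes `d - (n + 2)` disjoint paths from `0` to `1`: the numbers `n + 2, …, d - 1` are
copies of the terminals, one for each path, `p x` is the successor of `x`, and the players on
none of the paths run through loops or cycles. -/
structure PathSystem (n : ℕ) (Arc : ℕ → ℕ → Prop) (d : ℕ) (p : Equiv.Perm ℕ) : Prop where
  le : n + 2 ≤ d
  zero : p 0 = 0
  one : p 1 = 1
  fix : ∀ z, d ≤ z → p z = z
  legal : ∀ x, 2 ≤ x → x < d → Arc (tailOf n x) (headOf n (p x))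

theorem IsNetwork.pathSystem_one (hN : IsNetwork n Arc) : PathSystem n Arc (n + 2) 1 where
  le := le_rfl
  zero := rfl
  one := rfl
  fix _ _ := rfl
  legal x hx hx' := by
    simpa [tailOf_of_lt hx', headOf_of_lt hx'] using hN.self hx hx'

/-- Strong duality: let `V` be a set of vertices that contains `0`, is closed under moving from
`x` back along the path system to its predecessor and on along an arc, but does not contain
`1`. Then the players in `V` whose successors are outside `V` form a cut, and there
are at most as many of them as there are paths. -/
theorem PathSystem.welfare_le (hN : IsNetwork n Arc) {d : ℕ} {p : Equiv.Perm ℕ}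
    (hp : PathSystem n Arc d p) {g : CoalitionalGame n} (hg : IsGameOf g Arc) (V : Finset ℕ)
    (h0 : 0 ∈ V) (h1 : 1 ∉ V) (hcl : ∀ a b, Arc a b → p a ∈ V → b ∈ V) (π : CoalitionStructure n) :
    g.welfare π ≤ (d - (n + 2) : ℕ) := by
  classical
  let K : Finset (Fin n) := Finset.univ.filter fun x => (x + 2 : ℕ) ∈ V ∧ p (x + 2) ∉ V
  refine (hg.welfare_le_card K ?_ π).trans ?_
  · rintro C ⟨z, hz, hz1⟩
    by_contra! hC
    have key : ∀ x, Reach Arc C x → (x + 2 : ℕ) ∈ V ∧ p (x + 2) ∈ V := by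
      intro x hx
      have : (x + 2 : ℕ) ∈ V := by
        induction hx with
        | first _ h => exact hcl _ _ h (by rwa [hp.zero])
        | next h _ h' ih =>
          refine hcl _ _ h' ?_
          by_contra hh
          exact hC _ h.mem (Finset.mem_filter.2 ⟨Finset.mem_univ _, ih, hh⟩)
      refine ⟨this, ?_⟩
      by_contra hh
      exact hC _ hx.mem (Finset.mem_filter.2 ⟨Finset.mem_univ _, this, hh⟩)
    exact h1 (hcl _ _ hz1 (key z hz).2)
  · norm_cast
    let U : Finset ℕ := V.map p.symm.toEmbedding
    have hU : ∀ z, z ∈ U ↔ p z ∈ V := fun z => by simp [U]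
    have h₁ : K.card ≤ (V \ U).card := by
      refine Finset.card_le_card_of_injOn (fun x => (x + 2 : ℕ)) (fun x hx => ?_) ?_
      · have := (Finset.mem_filter.1 hx).2
        simpa [hU] using this
      · intro x _ y _ h
        exact Fin.ext (by simpa using h)
    have h₂ : (V \ U).card = (U \ V).card :=
      Finset.card_sdiff_comm (Finset.card_map _).symm
    have h₃ : U \ V ⊆ Finset.Ico (n + 2) d := by
      intro z hz
      rw [Finset.mem_sdiff, hU] at hz
      rw [Finset.mem_Ico]
      by_contra hcon
      rcases lt_or_ge z (n + 2) with hlt | hge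
      · rcases lt_or_ge z 2 with h | h
        · interval_cases z
          · exact hz.2 h0
          · exact h1 (hp.one ▸ hz.1)
        · exact hz.2 (hcl _ _ (hN.self h hlt) hz.1)
      · exact hz.2 (hp.fix z (by omega) ▸ hz.1)
    calc K.card ≤ (U \ V).card := h₁.trans h₂.le
      _ ≤ _ := (Finset.card_le_card h₃).trans (by simp)

end PathSystem

/-! ### The search for an augmenting path -/

section Search

variable {n : ℕ} {Arc : ℕ → ℕ → Prop}

/-- The set of the vertices that the search has visited. -/
def visited (n : ℕ) (par : ℕ → ℕ) : Finset ℕ := (Finset.range (n + 2)).filter (par · ≠ 0)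

/-- The result of a search from `0`: `par y = x + 1` means that `y` has been
visited as the head of the arc from `x`, after the successor `p x` of `x` (the vertex `0` counts as
visited from the start and as its own successor). The rank `rk` is the order of the visits. -/
structure SearchForest (n : ℕ) (Arc : ℕ → ℕ → Prop) (p : Equiv.Perm ℕ) (par rk : ℕ → ℕ) :
    Prop where
  zero : par 0 ≠ 0
  lt : ∀ {y}, par y ≠ 0 → y < n + 2
  parent : ∀ {y}, par y ≠ 0 → y ≠ 0 →
    ∃ x, par y = x + 1 ∧ Arc x y ∧ par (p x) ≠ 0 ∧ rk (p x) < rk y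
  rk_lt : ∀ {y}, par y ≠ 0 → rk y < (visited n par).card

theorem mem_visited {par : ℕ → ℕ} {y : ℕ} : y ∈ visited n par ↔ y < n + 2 ∧ par y ≠ 0 := by
  simp [visited]

theorem card_visited_le (par : ℕ → ℕ) : (visited n par).card ≤ n + 2 :=
  (Finset.card_filter_le _ _).trans (by simp)

theorem searchForest_init (p : Equiv.Perm ℕ) :
    SearchForest n Arc p (Function.update (fun _ => 0) 0 1) (fun _ => 0) where
  zero := by simp
  lt {y} hy := by
    by_cases h : y = 0 <;> simp_all
  parent {y} hy h := by simp_all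
  rk_lt {y} _ := Finset.card_pos.2 ⟨0, by simp [mem_visited]⟩

theorem visited_update {par : ℕ → ℕ} {b : ℕ} (hb : b < n + 2) (c : ℕ) :
    visited n (Function.update par b (c + 1)) = insert b (visited n par) := by
  ext y
  by_cases h : y = b <;> simp [mem_visited, h, hb]

theorem card_visited_update {par : ℕ → ℕ} {b : ℕ} (hb : b < n + 2) (h : par b = 0) (c : ℕ) :
    (visited n (Function.update par b (c + 1))).card = (visited n par).card + 1 := by
  rw [visited_update hb, Finset.card_insert_of_notMem (by simp [mem_visited, h])]

theorem SearchForest.update (hN : IsNetwork n Arc) {p : Equiv.Perm ℕ} {par rk : ℕ → ℕ}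
    (h : SearchForest n Arc p par rk) {a b : ℕ} (hab : Arc a b) (ha : par (p a) ≠ 0)
    (hb : par b = 0) :
    SearchForest n Arc p (Function.update par b (a + 1))
      (Function.update rk b (visited n par).card) := by
  have hne : ∀ {y}, par y ≠ 0 → y ≠ b := fun hy e => hy (e ▸ hb)
  constructor
  · rw [Function.update_of_ne (hne h.zero)]
    exact h.zero
  · intro y hy
    by_cases e : y = b
    · exact e ▸ hN.right_lt hab
    · rw [Function.update_of_ne e] at hy
      exact h.lt hy
  · intro y hy hy0
    by_cases e : y = b
    · subst e
      refine ⟨a, by simp, hab, ?_, ?_⟩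
      · rwa [Function.update_of_ne (hne ha)]
      · rw [Function.update_of_ne (hne ha), Function.update_self]
        exact h.rk_lt ha
    · rw [Function.update_of_ne e] at hy ⊢
      obtain ⟨x, h₁, h₂, h₃, h₄⟩ := h.parent hy hy0
      refine ⟨x, h₁, h₂, ?_, ?_⟩
      · rwa [Function.update_of_ne (hne h₃)]
      · rwa [Function.update_of_ne (hne h₃), Function.update_of_ne e]
  · intro y hy
    rw [card_visited_update (hN.right_lt hab) hb]
    by_cases e : y = b
    · subst e
      simp
    · rw [Function.update_of_ne e] at hy ⊢
      exact (h.rk_lt hy).trans (Nat.lt_succ_self _)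

end Search

/-! ### Augmentation -/

section Augmentation

variable {n : ℕ} {Arc : ℕ → ℕ → Prop}

/-- An intermediate stage `p` of the augmentation of `p₀` along the forest `par`: the new copy `d`
of the terminals has been put into the permutation, all arcs from `x ≠ d` are legal, and the arc
from `d` to `y = p d` remains to be repaired. What lies before `y` in the forest is unchanged. -/
structure Augmenting (n : ℕ) (Arc : ℕ → ℕ → Prop) (d : ℕ) (p₀ : Equiv.Perm ℕ) (par rk : ℕ → ℕ)
    (y : ℕ) (p : Equiv.Perm ℕ) : Prop where
  le : n + 2 ≤ d
  zero : p 0 = 0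
  one : p 1 = 1
  fix : ∀ z, d < z → p z = z
  legal : ∀ x, 2 ≤ x → x < d → Arc (tailOf n x) (headOf n (p x))
  apply_last : p d = y
  visited : par y ≠ 0
  rk_lt : rk y < rk 1
  agree : ∀ x, x ≠ d → par (p₀ x) ≠ 0 → rk (p₀ x) < rk y → p x = p₀ x

variable {d : ℕ} {p₀ p : Equiv.Perm ℕ} {par rk : ℕ → ℕ}

theorem Augmenting.ne_zero {y : ℕ} (h : Augmenting n Arc d p₀ par rk y p) : y ≠ 0 := by
  rintro rfl
  have := p.injective (h.apply_last.trans h.zero.symm)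
  have := h.le
  omega

/-- The first step of the augmentation: the predecessor of `1` in the forest becomes the
end of a path. -/
theorem PathSystem.augmenting (hN : IsNetwork n Arc) (hp : PathSystem n Arc d p₀)
    (hF : SearchForest n Arc p₀ par rk) (h1 : par 1 ≠ 0) :
    Augmenting n Arc d p₀ par rk (p₀ (par 1 - 1)) (p₀ * Equiv.swap d (par 1 - 1)) := by
  obtain ⟨x, hx, ha, hv, hr⟩ := hF.parent h1 one_ne_zero
  have hd := hp.le
  have hxn := hN.left_lt ha
  have hx0 : x ≠ 0 := by
    rintro rfl
    exact hN.not_direct ha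
  have hx1 : x ≠ 1 := by
    rintro rfl
    rw [hp.one] at hr
    exact lt_irrefl _ hr
  rw [hx, Nat.add_sub_cancel]
  constructor
  · exact hd
  · rw [Equiv.Perm.mul_apply, Equiv.swap_apply_of_ne_of_ne (by omega) (by omega), hp.zero]
  · rw [Equiv.Perm.mul_apply, Equiv.swap_apply_of_ne_of_ne (by omega) (by omega), hp.one]
  · intro z hz
    rw [Equiv.Perm.mul_apply, Equiv.swap_apply_of_ne_of_ne (by omega) (by omega), hp.fix z hz.le]
  · intro z hz hz'
    rw [Equiv.Perm.mul_apply]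
    by_cases e : z = x
    · subst e
      rwa [Equiv.swap_apply_right, hp.fix d le_rfl, headOf_of_le hd, tailOf_of_lt hxn]
    · rw [Equiv.swap_apply_of_ne_of_ne (by omega) e]
      exact hp.legal z hz hz'
  · simp
  · exact hv
  · exact hr
  · intro z hz _ hz'
    rw [Equiv.Perm.mul_apply, Equiv.swap_apply_of_ne_of_ne hz]
    rintro rfl
    exact lt_irrefl _ hz'

/-- The step from `y` to the successor of its predecessor in the forest. -/
theorem Augmenting.step (hN : IsNetwork n Arc) (h₀ : p₀ 1 = 1)
    (hF : SearchForest n Arc p₀ par rk) {y : ℕ} (h : Augmenting n Arc d p₀ par rk y p)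
    (hy : par y - 1 ≠ 0) :
    p (par y - 1) = p₀ (par y - 1) ∧ rk (p₀ (par y - 1)) < rk y ∧ par y - 1 < d ∧
    Augmenting n Arc d p₀ par rk (p₀ (par y - 1)) (p * Equiv.swap d (par y - 1)) := by
  obtain ⟨x, hx, ha, hv, hr⟩ := hF.parent h.visited h.ne_zero
  have hd := h.le
  have hxn := hN.left_lt ha
  rw [hx, Nat.add_sub_cancel] at hy ⊢
  have hx1 : x ≠ 1 := by
    rintro rfl
    rw [h₀] at hr
    exact lt_asymm hr h.rk_lt
  have hpx : p x = p₀ x := h.agree x (by omega) hv hr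
  refine ⟨hpx, hr, by omega, ?_⟩
  constructor
  · exact hd
  · rw [Equiv.Perm.mul_apply, Equiv.swap_apply_of_ne_of_ne (by omega) (by omega), h.zero]
  · rw [Equiv.Perm.mul_apply, Equiv.swap_apply_of_ne_of_ne (by omega) (by omega), h.one]
  · intro z hz
    rw [Equiv.Perm.mul_apply, Equiv.swap_apply_of_ne_of_ne (by omega) (by omega), h.fix z hz]
  · intro z hz hz'
    rw [Equiv.Perm.mul_apply]
    by_cases e : z = x
    · subst e
      rwa [Equiv.swap_apply_right, h.apply_last, headOf_of_lt (hF.lt h.visited), tailOf_of_lt hxn]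
    · rw [Equiv.swap_apply_of_ne_of_ne (by omega) e]
      exact h.legal z hz hz'
  · simp [hpx]
  · exact hv
  · exact hr.trans h.rk_lt
  · intro z hz hz' hz''
    rw [Equiv.Perm.mul_apply, Equiv.swap_apply_of_ne_of_ne hz]
    · exact h.agree z hz hz' (hz''.trans hr)
    · rintro rfl
      exact lt_irrefl _ hz''

/-- Once the walk back along the forest arrives at `0`, the remaining arc is legal as well. -/
theorem Augmenting.pathSystem (hF : SearchForest n Arc p₀ par rk) {y : ℕ}
    (h : Augmenting n Arc d p₀ par rk y p) (hy : par y - 1 = 0) : PathSystem n Arc (d + 1) p := by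
  obtain ⟨x, hx, ha, -, -⟩ := hF.parent h.visited h.ne_zero
  obtain rfl : x = 0 := by omega
  refine ⟨h.le.trans (Nat.le_succ d), h.zero, h.one, fun z hz => h.fix z hz, fun z hz hz' => ?_⟩
  rcases Nat.lt_succ_iff_lt_or_eq.1 hz' with hlt | rfl
  · exact h.legal z hz hlt
  · rwa [h.apply_last, tailOf_of_le h.le, headOf_of_lt (hF.lt h.visited)]

end Augmentation

/-! ### The paths of a path system -/

section Segment

variable {n : ℕ} {Arc : ℕ → ℕ → Prop}

/-- `y` is a player on the path that starts with the copy `q` of the terminals. -/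
inductive Segment (n : ℕ) (p : Equiv.Perm ℕ) (q : ℕ) : ℕ → Prop
  | first : p q < n + 2 → Segment n p q (p q)
  | next {y : ℕ} : Segment n p q y → p y < n + 2 → Segment n p q (p y)

theorem Segment.lt {p : Equiv.Perm ℕ} {q y : ℕ} (h : Segment n p q y) : y < n + 2 := by
  cases h <;> assumption

/-- Different paths are disjoint. -/
theorem Segment.unique {p : Equiv.Perm ℕ} {q q' y : ℕ} (hq : n + 2 ≤ q) (hq' : n + 2 ≤ q')
    (h : Segment n p q y) (h' : Segment n p q' y) : q = q' := by
  induction h generalizing q' with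
  | first _ =>
    generalize hz : p q = z at h'
    cases h' with
    | first _ => exact p.injective hz
    | next h' _ =>
      have := h'.lt
      have := p.injective hz
      omega
  | @next y h _ ih =>
    generalize hz : p y = z at h'
    cases h' with
    | first _ =>
      have := h.lt
      have := p.injective hz
      omega
    | next h' _ => exact ih hq' (p.injective hz ▸ h')

/-- The path that starts with `q` leaves the players after at most `n + 2` steps, because a
permutation cannot run into a cycle. -/
theorem exists_iterate_ge (p : Equiv.Perm ℕ) {q : ℕ} (hq : n + 2 ≤ q) :
    ∃ j ≤ n + 2, n + 2 ≤ p^[j + 1] q := by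
  by_contra! h
  obtain ⟨i, hi, j, hj, hne, he⟩ := Finset.exists_ne_map_eq_of_card_lt_of_maps_to
    (s := Finset.range (n + 3)) (t := Finset.range (n + 2)) (by simp)
    (f := fun j => p^[j + 1] q) (fun j hj => by
      have := h j (by simp at hj; omega)
      simpa using this)
  wlog hij : i < j generalizing i j
  · exact this j hj i hi hne.symm he.symm (by omega)
  have : q = p^[j - i] q := by
    refine (p.injective.iterate (i + 1)) ?_
    rw [← Function.iterate_add_apply]
    convert he using 2
    omega
  have h' := h (j - i - 1) (by simp at hj; omega)
  rw [show j - i - 1 + 1 = j - i by omega, ← this] at h'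
  omega

variable {d : ℕ} {p : Equiv.Perm ℕ} {q : ℕ}

/-- The players on the path of `q` that `L` gives the label `q`. -/
noncomputable def labelled (n : ℕ) (p : Equiv.Perm ℕ) (L : ℕ → ℕ) (q : ℕ) : Finset (Fin n) :=
  open Classical in Finset.univ.filter fun i : Fin n => L i = q ∧ Segment n p q (i + 2)

theorem mem_labelled {L : ℕ → ℕ} {i : Fin n} :
    i ∈ labelled n p L q ↔ L i = q ∧ Segment n p q (i + 2) := by
  simp [labelled]

/-- Writing labels along the path of `q` has arrived at `x`. -/
def LabelFront (n : ℕ) (Arc : ℕ → ℕ → Prop) (p : Equiv.Perm ℕ) (L : ℕ → ℕ) (q x : ℕ) : Prop :=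
  x = p q ∨ ∃ y : Fin n, Reach Arc (labelled n p L q) y ∧ x = p (y + 2)

theorem PathSystem.two_le_apply (hp : PathSystem n Arc d p) {y : ℕ} (hy : 2 ≤ y) : 2 ≤ p y := by
  by_contra h
  have h' : p y = 0 ∨ p y = 1 := by omega
  rcases h' with h' | h'
  · have := p.injective (h'.trans hp.zero.symm)
    omega
  · have := p.injective (h'.trans hp.one.symm)
    omega

theorem LabelFront.two_le {L : ℕ → ℕ} {x : ℕ} (hp : PathSystem n Arc d p)
    (hq : n + 2 ≤ q) (h : LabelFront n Arc p L q x) : 2 ≤ x := by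
  rcases h with rfl | ⟨y, _, rfl⟩ <;> exact hp.two_le_apply (by omega)

theorem LabelFront.segment {L : ℕ → ℕ} {x : ℕ} (hx : x < n + 2)
    (h : LabelFront n Arc p L q x) : Segment n p q x := by
  rcases h with rfl | ⟨y, hy, rfl⟩
  · exact .first hx
  · exact .next (mem_labelled.1 hy.mem).2 hx

theorem LabelFront.step {L : ℕ → ℕ} {x : ℕ} (hp : PathSystem n Arc d p)
    (hq : n + 2 ≤ q) (hqd : q < d) (hx : x < n + 2) (h : LabelFront n Arc p L q x) :
    LabelFront n Arc p (Function.update L (x - 2) q) q (p x) := by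
  have h2 := h.two_le hp hq
  have hs := h.segment hx
  have hd := hp.le
  have hsub : labelled n p L q ⊆ labelled n p (Function.update L (x - 2) q) q := by
    intro i
    simp only [mem_labelled, Function.update_apply]
    rintro ⟨h₁, h₂⟩
    exact ⟨by simp [h₁], h₂⟩
  have hmem : (⟨x - 2, by omega⟩ : Fin n) ∈ labelled n p (Function.update L (x - 2) q) q := by
    simp only [mem_labelled, Function.update_self, true_and]
    rwa [Nat.sub_add_cancel h2]
  refine .inr ⟨⟨x - 2, by omega⟩, ?_, by simp only [Nat.sub_add_cancel h2]⟩
  rcases h with rfl | ⟨y, hy, rfl⟩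
  · refine .first hmem ?_
    have := hp.legal q (by omega) hqd
    rw [tailOf_of_le hq, headOf_of_lt hx] at this
    simpa only [Nat.sub_add_cancel h2] using this
  · refine .next (hy.mono hsub) hmem ?_
    have := hp.legal (y + 2) (by omega) (by omega)
    rw [tailOf_of_lt (by omega), headOf_of_lt hx] at this
    simpa only [Nat.sub_add_cancel h2] using this

/-- When all players on the path of `q` have got the label `q`, they form a winning
coalition. -/
theorem LabelFront.winning {L : ℕ → ℕ} {x : ℕ} (hN : IsNetwork n Arc) (hp : PathSystem n Arc d p)
    (hq : n + 2 ≤ q) (hqd : q < d) (hx : n + 2 ≤ x) (h : LabelFront n Arc p L q x) :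
    Winning Arc (labelled n p L q) := by
  have hd := hp.le
  rcases h with rfl | ⟨y, hy, rfl⟩
  · have := hp.legal q (by omega) hqd
    rw [tailOf_of_le hq, headOf_of_le hx] at this
    exact (hN.not_direct this).elim
  · have := hp.legal (y + 2) (by omega) (by omega)
    rw [tailOf_of_lt (by omega), headOf_of_le hx] at this
    exact ⟨y, hy, this⟩

end Segment

/-! ### The augmenting path program -/

/- Registers: the length of the output, the constant `1`, the number `n` of players, the number
`n + 2` of vertices, the number of arcs, the next copy `d` of the terminals, loop counters, and
temporaries. -/
local notation "rLen" => (0 : ℕ)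
local notation "rOne" => (1 : ℕ)
local notation "rPlayers" => (2 : ℕ)
local notation "rVerts" => (3 : ℕ)
local notation "rArcs" => (4 : ℕ)
local notation "rNext" => (5 : ℕ)
local notation "rK" => (6 : ℕ)
local notation "rR" => (7 : ℕ)
local notation "rP" => (8 : ℕ)
local notation "rX" => (9 : ℕ)
local notation "rY" => (10 : ℕ)
local notation "rZ" => (11 : ℕ)
local notation "rT" => (12 : ℕ)

/- Arrays: input, output (labels), tails and heads of the arcs, the permutation, the search
forest. -/
local notation "aIn" => (0 : ℕ)
local notation "aOut" => (1 : ℕ)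
local notation "aTail" => (2 : ℕ)
local notation "aHead" => (3 : ℕ)
local notation "aSucc" => (4 : ℕ)
local notation "aPar" => (5 : ℕ)

/-- Do nothing (but spoil a temporary register). -/
def skip : Program := .const rT 0

/-- Empty the search forest, except for the root `0`. -/
def clearForest : Program :=
  copy rK rVerts ;;
  countdown rK (.const rT 0 ;; .store aPar rK rT) ;;
  .const rT 0 ;; .store aPar rT rOne

/-- Visit the head of the arc number `rK`, if this is possible and has not been done. -/
def relaxArc : Program :=
  .load rX aTail rK ;; .load rY aHead rK ;; .load rZ aSucc rX ;; .load rZ aPar rZ ;;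
  .cond rZ
    (.load rZ aPar rY ;; .cond rZ skip (.add rZ rX rOne ;; .store aPar rY rZ))
    skip

/-- One round of the search: every arc is considered once. -/
def scanArcs : Program := copy rK rArcs ;; countdown rK relaxArc

/-- As many rounds as there are vertices, so that the last one finds nothing new. -/
def search : Program := clearForest ;; copy rR rVerts ;; countdown rR scanArcs

/-- Augment the path system along the path to `1` in the search forest. -/
def augment : Program :=
  (.load rX aPar rOne ;; .sub rX rX rOne ;; .load rY aSucc rX ;; .store aSucc rX rNext ;;
    .load rX aPar rY ;; .sub rX rX rOne) ;;
  .loop rX (.load rZ aSucc rX ;; .store aSucc rX rY ;; copy rY rZ ;;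
    .load rX aPar rY ;; .sub rX rX rOne) ;;
  .store aSucc rNext rY ;; .add rNext rNext rOne

/-- Search, and augment if `1` has been visited. (The register `rOne` serves as the address `1`.) -/
def phase : Program := search ;; .load rX aPar rOne ;; .cond rX augment skip

/-- Start with the empty path system, in which every player runs through its loop. -/
def initPaths : Program :=
  copy rK rVerts ;; countdown rK (.store aSucc rK rK) ;; copy rNext rVerts

/-- Label the players on the path number `rK`. -/
def labelPath : Program :=
  (.add rY rVerts rK ;; .load rX aSucc rY ;; .sub rT rVerts rX) ;;
  .loop rT (.sub rZ rX rOne ;; .sub rZ rZ rOne ;; .store aOut rZ rY ;; .load rX aSucc rX ;;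
    .sub rT rVerts rX)

def labelPaths : Program := .sub rK rNext rVerts ;; countdown rK labelPath

/-- Find as many disjoint paths as possible in a network, and output a labelling of its players
in which each path has its own label. -/
def disjointPaths : Program :=
  initPaths ;; copy rP rPlayers ;; countdown rP phase ;; labelPaths ;; copy rLen rPlayers

/-! ### Correctness of the augmenting path program -/

variable {n M : ℕ} {Arc : ℕ → ℕ → Prop}

/-- The memory holds a network with `n` players and `M` arcs. -/
structure Holds (n M : ℕ) (Arc : ℕ → ℕ → Prop) (σ : State) : Prop where
  one : σ.reg rOne = 1
  players : σ.reg rPlayers = n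
  verts : σ.reg rVerts = n + 2
  arcs : σ.reg rArcs = M
  mem : ∀ x y, Arc x y ↔ ∃ k < M, σ.arr aTail k = x ∧ σ.arr aHead k = y

theorem Holds.frame {P : Program} {σ σ' : State} (h : Holds n M Arc σ) (hF : Frame P σ σ')
    (hr : [1, 2, 3, 4].any P.writesReg = false) (ha : [2, 3].any P.writesArr = false) :
    Holds n M Arc σ' := by
  simp only [List.any_cons, List.any_nil, Bool.or_false, Bool.or_eq_false_iff] at hr ha
  refine ⟨?_, ?_, ?_, ?_, ?_⟩
  · rw [hF.1 _ hr.1, h.one]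
  · rw [hF.1 _ hr.2.1, h.players]
  · rw [hF.1 _ hr.2.2.1, h.verts]
  · rw [hF.1 _ hr.2.2.2, h.arcs]
  · rw [hF.2 _ ha.1, hF.2 _ ha.2]
    exact h.mem

/-- The memory holds the path system `p`. -/
structure HoldsPaths (n : ℕ) (Arc : ℕ → ℕ → Prop) (d : ℕ) (p : Equiv.Perm ℕ) (σ : State) :
    Prop where
  next : σ.reg rNext = d
  succ : ∀ z < d, σ.arr aSucc z = p z
  system : PathSystem n Arc d p

theorem HoldsPaths.frame {P : Program} {σ σ' : State} {d : ℕ} {p : Equiv.Perm ℕ}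
    (h : HoldsPaths n Arc d p σ) (hF : Frame P σ σ') (hr : P.writesReg 5 = false)
    (ha : P.writesArr 4 = false) : HoldsPaths n Arc d p σ' :=
  ⟨by rw [hF.1 _ hr, h.next], by rw [hF.2 _ ha]; exact h.succ, h.system⟩

theorem runs_clearForest {σ : State} (h : Holds n M Arc σ)
    (hpar : ∀ y, n + 2 ≤ y → σ.arr aPar y = 0) :
    Runs clearForest (2 + (((n + 2) * (2 + 2) + 1) + 2))
      (fun σ' => σ'.arr aPar = Function.update (fun _ => 0) 0 1) σ := by
  refine Runs.sem_seq rfl le_rfl (Runs.seq_frame (Runs.countdown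
    (I := fun i σ' => ∀ y, i ≤ y → σ'.arr aPar y = 0) ?_ ?_ ?_ rfl rfl ?_) ?_)
  · simp [copy, sem, h.one]
  · simp [copy, sem, h.verts]
  · simpa [copy, sem] using hpar
  · intro i _ σ' _ _ hI
    refine Runs.of_sem rfl le_rfl ?_
    intro y hy
    by_cases e : y = i
    · simp [sem, e]
    · simpa [sem, e] using hI y (by omega)
  · intro σ' hI hF
    have h1 : σ'.reg 1 = 1 := (hF.1 1 rfl).trans (by simp [copy, sem, h.one])
    refine Runs.of_sem rfl le_rfl ?_
    funext y
    simp [sem, h1, Function.update_apply, hI]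

theorem runs_relaxArc {σ : State} (h1 : σ.reg rOne = 1) :
    Runs relaxArc 9 (fun σ' => σ'.arr aPar =
      if σ.arr aPar (σ.arr aSucc (σ.arr aTail (σ.reg rK))) ≠ 0 ∧
        σ.arr aPar (σ.arr aHead (σ.reg rK)) = 0 then
        Function.update (σ.arr aPar) (σ.arr aHead (σ.reg rK)) (σ.arr aTail (σ.reg rK) + 1)
      else σ.arr aPar) σ := by
  refine Runs.of_sem rfl (by decide) ?_
  by_cases h2 : σ.arr aPar (σ.arr aSucc (σ.arr aTail (σ.reg rK))) = 0 <;>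
  by_cases h3 : σ.arr aPar (σ.arr aHead (σ.reg rK)) = 0 <;>
  simp [relaxArc, skip, sem, h1, h2, h3]

/-- The search cannot be extended any further. -/
def SearchClosed (Arc : ℕ → ℕ → Prop) (p : Equiv.Perm ℕ) (par : ℕ → ℕ) : Prop :=
  ∀ a b, Arc a b → par (p a) ≠ 0 → par b ≠ 0

/-- A round of the search either visits a new vertex or shows that there is none to visit. -/
theorem runs_scanArcs (hN : IsNetwork n Arc) {d : ℕ} {p : Equiv.Perm ℕ} {σ : State}
    (h : Holds n M Arc σ) (hp : HoldsPaths n Arc d p σ) {rk : ℕ → ℕ}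
    (hrk : SearchForest n Arc p (σ.arr aPar) rk) :
    Runs scanArcs (2 + (M * (9 + 2) + 1)) (fun σ' =>
      (∃ rk', SearchForest n Arc p (σ'.arr aPar) rk') ∧
      (SearchClosed Arc p (σ'.arr aPar) ∨
        (visited n (σ.arr aPar)).card < (visited n (σ'.arr aPar)).card) ∧
      (SearchClosed Arc p (σ.arr aPar) → SearchClosed Arc p (σ'.arr aPar))) σ := by
  have hM : ∀ k < M, Arc (σ.arr aTail k) (σ.arr aHead k) := fun k hk =>
    (h.mem _ _).2 ⟨k, hk, rfl, rfl⟩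
  refine Runs.sem_seq rfl le_rfl ((Runs.countdown
    (I := fun i σ' => (∃ rk', SearchForest n Arc p (σ'.arr aPar) rk') ∧
      ((σ'.arr aPar = σ.arr aPar ∧ ∀ k, i ≤ k → k < M →
          σ.arr aPar (p (σ.arr aTail k)) ≠ 0 → σ.arr aPar (σ.arr aHead k) ≠ 0) ∨
        (visited n (σ.arr aPar)).card < (visited n (σ'.arr aPar)).card) ∧
      (SearchClosed Arc p (σ.arr aPar) → σ'.arr aPar = σ.arr aPar))
    ?_ ?_ ?_ rfl rfl ?_).mono le_rfl ?_)
  · simp [copy, sem, h.one]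
  · simp [copy, sem, h.arcs]
  · refine ⟨⟨rk, by simpa [copy, sem] using hrk⟩, .inl ⟨by simp [copy, sem], ?_⟩,
      fun _ => by simp [copy, sem]⟩
    intro k hk hk'
    omega
  · rintro i hi σ' hF hx ⟨⟨rk', hrk'⟩, hI, hcl⟩
    have h1 : σ'.reg 1 = 1 := (hF.1 1 rfl).trans (by simp [copy, sem, h.one])
    have hT : σ'.arr aTail = σ.arr aTail := (hF.2 _ rfl).trans (by simp [copy, sem])
    have hH : σ'.arr aHead = σ.arr aHead := (hF.2 _ rfl).trans (by simp [copy, sem])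
    have hS : σ'.arr aSucc = σ.arr aSucc := (hF.2 _ rfl).trans (by simp [copy, sem])
    have hi' := hM i hi
    have hSi : σ.arr aSucc (σ.arr aTail i) = p (σ.arr aTail i) :=
      hp.succ _ ((hN.left_lt hi').trans_le hp.system.le)
    refine (runs_relaxArc (σ := σ'.setReg rK i) (by simpa using h1)).mono le_rfl fun σ'' h'' => ?_
    simp only [State.setReg_arr, State.setReg_reg, hT, hH, hS, if_pos, hSi] at h''
    split_ifs at h'' with hc
    · rw [h'']
      have hcard := card_visited_update (hN.right_lt hi') hc.2 (σ.arr aTail i)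
      refine ⟨⟨_, hrk'.update hN hi' hc.1 hc.2⟩, .inr ?_, fun hcl' => ?_⟩
      · rw [hcard]
        rcases hI with hI | hI
        · rw [hI.1]
          exact Nat.lt_succ_self _
        · omega
      · rw [hcl hcl'] at hc
        exact (hcl' _ _ hi' hc.1 hc.2).elim
    · rw [h'']
      refine ⟨⟨_, hrk'⟩, hI.imp_left ?_, hcl⟩
      rintro ⟨he, hI⟩
      refine ⟨he, fun k hk hk' => ?_⟩
      rcases hk.eq_or_lt with rfl | hlt
      · rw [he] at hc
        tauto
      · exact hI k hlt hk'
  · rintro σ' ⟨hrk', hI, hcl⟩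
    refine ⟨hrk', hI.imp_left ?_, fun hcl' => hcl hcl' ▸ hcl'⟩
    rintro ⟨he, hI⟩ a b hab ha
    obtain ⟨k, hk, rfl, rfl⟩ := (h.mem _ _).1 hab
    rw [he] at ha ⊢
    exact hI k (Nat.zero_le _) hk ha

/-- A round after which the search is not closed has visited a new vertex, so that `n + 2` rounds
suffice. -/
theorem runs_search (hN : IsNetwork n Arc) {d : ℕ} {p : Equiv.Perm ℕ} {σ : State}
    (h : Holds n M Arc σ) (hp : HoldsPaths n Arc d p σ)
    (hpar : ∀ y, n + 2 ≤ y → σ.arr aPar y = 0) :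
    Runs search ((2 + (((n + 2) * (2 + 2) + 1) + 2)) +
        (2 + ((n + 2) * ((2 + (M * (9 + 2) + 1)) + 2) + 1)))
      (fun σ' => (∃ rk, SearchForest n Arc p (σ'.arr aPar) rk) ∧
        SearchClosed Arc p (σ'.arr aPar)) σ := by
  refine Runs.seq_frame (runs_clearForest h hpar) fun σ₁ h₁ hF₁ => ?_
  have hσ₁ := h.frame hF₁ rfl rfl
  have hp₁ := hp.frame hF₁ rfl rfl
  refine Runs.sem_seq rfl le_rfl ((Runs.countdown
    (I := fun i σ' => (∃ rk, SearchForest n Arc p (σ'.arr aPar) rk) ∧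
      (SearchClosed Arc p (σ'.arr aPar) ∨ n + 2 - i ≤ (visited n (σ'.arr aPar)).card))
    ?_ ?_ ?_ rfl rfl ?_).mono le_rfl ?_)
  · simp [copy, sem, hσ₁.one]
  · simp [copy, sem, hσ₁.verts]
  · refine ⟨⟨fun _ => 0, ?_⟩, .inr (by simp)⟩
    · simp only [copy, sem, State.setReg_arr, h₁]
      exact searchForest_init p
  · rintro i hi σ' hF hx ⟨⟨rk, hrk⟩, hI⟩
    have hσ' := ((hσ₁.frame (.sem (P := copy rR rVerts) rfl σ₁) rfl rfl).frame hF rfl rfl).frame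
      (.setReg σ' rR i) rfl rfl
    have hp' := ((hp₁.frame (.sem (P := copy rR rVerts) rfl σ₁) rfl rfl).frame hF rfl rfl).frame
      (.setReg σ' rR i) rfl rfl
    refine (runs_scanArcs hN hσ' hp' (rk := rk) hrk).mono
      le_rfl ?_
    rintro σ'' ⟨hrk'', h₂, h₃⟩
    refine ⟨hrk'', ?_⟩
    rcases hI with hI | hI
    · exact .inl (h₃ hI)
    · refine h₂.imp_right fun h₂ => ?_
      simp only [State.setReg_arr] at h₂
      omega
  · rintro σ' ⟨hrk, hI⟩
    refine ⟨hrk, hI.elim id fun hI => ?_⟩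
    -- all vertices have been visited
    intro a b hab _
    have : visited n (σ'.arr aPar) = Finset.range (n + 2) :=
      Finset.eq_of_subset_of_card_le (Finset.filter_subset _ _) (by simpa using hI)
    have hb : b ∈ visited n (σ'.arr aPar) := by
      rw [this, Finset.mem_range]
      exact hN.right_lt hab
    exact (mem_visited.1 hb).2

/-- After the augmentation there is one path more. -/
theorem runs_augment (hN : IsNetwork n Arc) {d : ℕ} {p : Equiv.Perm ℕ} {σ : State}
    (h : Holds n M Arc σ) (hp : HoldsPaths n Arc d p σ) {rk : ℕ → ℕ}
    (hF : SearchForest n Arc p (σ.arr aPar) rk) (h1 : σ.arr aPar 1 ≠ 0) :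
    Runs augment (6 + (((n + 2) * (6 + 1) + 1) + 2))
      (fun σ' => ∃ p', HoldsPaths n Arc (d + 1) p' σ') σ := by
  have hone := h.one
  have hd := hp.system.le
  obtain ⟨x, hx, ha, -, -⟩ := hF.parent h1 one_ne_zero
  have hxd := (hN.left_lt ha).trans_le hd
  have hrk1 : rk 1 ≤ n + 2 := (hF.rk_lt h1).le.trans (card_visited_le _)
  -- the array holds `p'` except at `d`, whose image is kept in `rY` until the loop is over
  refine Runs.sem_seq rfl le_rfl (Runs.seq_frame ((Runs.loop (v := rk 1)
    (I := fun v σ' => ∃ p' y, y = σ'.reg rY ∧ rk y ≤ v ∧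
      Augmenting n Arc d p (σ.arr aPar) rk y p' ∧ (∀ z < d, σ'.arr aSucc z = p' z) ∧
      σ'.reg rX = σ.arr aPar y - 1 ∧ σ'.reg rNext = d ∧ σ'.arr aPar = σ.arr aPar) ?_ ?_).mono
        (by gcongr) fun _ h => h) ?_)
  · have hA := hp.system.augmenting hN hF h1
    refine ⟨_, _, ?_, hA.rk_lt.le, hA, ?_, ?_, ?_, ?_⟩
    · simp [sem, hone, hx, hp.succ x hxd]
    · intro z hz
      rw [Equiv.Perm.mul_apply]
      by_cases e : z = x
      · subst e
        simp [sem, hone, hx, hp.next, hp.system.fix d le_rfl]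
      · rw [hx, Nat.add_sub_cancel, Equiv.swap_apply_of_ne_of_ne hz.ne e]
        simp [sem, hone, hx, e, hp.succ z hz]
    · simp [sem, hone, hx, hp.succ x hxd]
    · simp [sem, hp.next]
    · simp [sem]
  · rintro v σ' ⟨p', y, hy, hv, hA, hS, hX, hD, hP⟩ hFr h0
    have h1' : σ'.reg 1 = 1 := (hFr.1 1 rfl).trans (by simp [sem, h.one])
    rw [hX] at h0
    obtain ⟨hpx, hr, hlt, hA'⟩ := hA.step hN hp.system.one hF h0
    refine Runs.of_sem rfl (by decide) ⟨_, hr.trans_le hv, _, _, ?_, le_rfl, hA', ?_, ?_, ?_, ?_⟩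
    · simp [sem, copy, hX, hS _ hlt, hpx]
    · intro z hz
      rw [Equiv.Perm.mul_apply]
      by_cases e : z = σ.arr aPar y - 1
      · subst e
        simp [sem, copy, hX, hA.apply_last, hy]
      · rw [Equiv.swap_apply_of_ne_of_ne hz.ne e]
        simp [sem, copy, hX, e, hS z hz]
    · simp [sem, copy, hX, hS _ hlt, hpx, hP, h1']
    · simp [sem, copy, hD]
    · simp [sem, copy, hP]
  · rintro σ' ⟨⟨v, p', y, hy, -, hA, hS, hX, hD, hP⟩, h0⟩ hFr
    have h1' : σ'.reg 1 = 1 := (hFr.1 1 rfl).trans (by simp [sem, h.one])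
    refine Runs.of_sem rfl le_rfl ⟨p', ?_, ?_, hA.pathSystem hF (hX.symm.trans h0)⟩
    · simp [sem, hD, h1']
    · intro z hz
      rcases Nat.lt_succ_iff_lt_or_eq.1 hz with hlt | rfl
      · simp [sem, hD, hlt.ne, hS z hlt]
      · simp [sem, hD, hA.apply_last, hy]

/-- `k` bounds the social welfare that the game of the network admits. -/
def WelfareBound (n : ℕ) (Arc : ℕ → ℕ → Prop) (k : ℕ) : Prop :=
  ∀ g : CoalitionalGame n, IsGameOf g Arc → ∀ π, g.welfare π ≤ k

theorem welfareBound_players : WelfareBound n Arc n := fun g hg π => by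
  simpa using hg.welfare_le_card Finset.univ
    (fun C ⟨x, hx, _⟩ => ⟨x, hx.mem, Finset.mem_univ x⟩) π

/-- The time bound for one phase. -/
def phaseTime (n M : ℕ) : ℕ :=
  ((2 + (((n + 2) * (2 + 2) + 1) + 2)) + (2 + ((n + 2) * ((2 + (M * (9 + 2) + 1)) + 2) + 1))) +
    (1 + ((6 + (((n + 2) * (6 + 1) + 1) + 2)) + 1))

/-- A phase adds a path, unless the path system is already optimal. -/
theorem runs_phase (hN : IsNetwork n Arc) {d : ℕ} {p : Equiv.Perm ℕ} {σ : State}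
    (h : Holds n M Arc σ) (hp : HoldsPaths n Arc d p σ)
    (hpar : ∀ y, n + 2 ≤ y → σ.arr aPar y = 0) :
    Runs phase (phaseTime n M) (fun σ' => (∀ y, n + 2 ≤ y → σ'.arr aPar y = 0) ∧
      ((∃ p', HoldsPaths n Arc (d + 1) p' σ') ∨
        HoldsPaths n Arc d p σ' ∧ WelfareBound n Arc (d - (n + 2)))) σ := by
  refine Runs.seq_frame (runs_search hN h hp hpar) ?_
  rintro σ₁ ⟨⟨rk, hrk⟩, hcl⟩ hF
  have hpar₁ : ∀ y, n + 2 ≤ y → σ₁.arr aPar y = 0 := fun y hy => by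
    by_contra h0
    exact absurd (hrk.lt h0) (by omega)
  have hσ₁ := h.frame hF rfl rfl
  have hp₁ := hp.frame hF rfl rfl
  have hF₂ := Frame.sem (P := .load rX aPar rOne) rfl σ₁
  refine Runs.sem_seq rfl le_rfl (Runs.cond (fun h0 => ?_) (fun h0 => ?_))
  · simp only [sem, State.setReg_reg, if_pos, hσ₁.one] at h0
    refine (runs_augment hN (hσ₁.frame hF₂ rfl rfl) (hp₁.frame hF₂ rfl rfl) hrk h0).frame.mono
      le_rfl fun σ' hσ' => ⟨?_, .inl hσ'.1⟩
    rw [hσ'.2.2 aPar rfl]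
    exact hpar₁
  · simp only [sem, State.setReg_reg, if_pos, hσ₁.one] at h0
    refine Runs.of_sem rfl (by simp [skip, steps]; omega) ⟨hpar₁, .inr ⟨(hp₁.frame hF₂ rfl rfl).frame
      (Frame.sem (P := skip) rfl _) rfl rfl, fun g hg π => ?_⟩⟩
    refine hp.system.welfare_le hN hg (visited n (σ₁.arr aPar)) ?_ ?_ ?_ π
    · exact mem_visited.2 ⟨by omega, hrk.zero⟩
    · simp [mem_visited, h0]
    · intro a b hab ha
      exact mem_visited.2 ⟨hN.right_lt hab, hcl a b hab (mem_visited.1 ha).2⟩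

theorem runs_initPaths (hN : IsNetwork n Arc) {σ : State} (h : Holds n M Arc σ) :
    Runs initPaths (2 + (((n + 2) * (1 + 2) + 1) + 2))
      (fun σ' => HoldsPaths n Arc (n + 2) 1 σ') σ := by
  refine Runs.sem_seq rfl le_rfl (Runs.seq_frame (Runs.countdown
    (I := fun i σ' => ∀ y, i ≤ y → y < n + 2 → σ'.arr aSucc y = y) ?_ ?_ ?_ rfl rfl ?_) ?_)
  · simp [copy, sem, h.one]
  · simp [copy, sem, h.verts]
  · intro y hy hy'
    omega
  · intro i _ σ' _ _ hI
    refine Runs.of_sem rfl le_rfl ?_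
    intro y hy hy'
    by_cases e : y = i
    · simp [sem, e]
    · simpa [sem, e] using hI y (by omega) hy'
  · intro σ' hI hF
    have hv : σ'.reg rVerts = n + 2 := (hF.1 _ rfl).trans (by simp [copy, sem, h.verts])
    refine Runs.of_sem rfl le_rfl ⟨?_, ?_, hN.pathSystem_one⟩
    · simp [sem, copy, hv]
    · intro z hz
      simp [sem, copy, hI z (Nat.zero_le _) hz]

/-- The players on the path of `q` get the label `q`, and no other label is changed. -/
theorem runs_labelPath (hN : IsNetwork n Arc) {d : ℕ} {p : Equiv.Perm ℕ} {σ : State}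
    (h : Holds n M Arc σ) (hp : HoldsPaths n Arc d p σ) {q : ℕ} (hq : n + 2 ≤ q) (hqd : q < d)
    (hσq : q = n + 2 + σ.reg rK) :
    Runs labelPath (3 + ((n + 2) * (5 + 1) + 1)) (fun σ' =>
      Winning Arc (labelled n p (σ'.arr aOut) q) ∧
      ∀ i : Fin n, ¬ Segment n p q (i + 2) → σ'.arr aOut i = σ.arr aOut i) σ := by
  obtain ⟨J, hJ, hJ'⟩ := exists_iterate_ge p hq
  have hd := hp.system.le
  refine Runs.sem_seq rfl le_rfl ((Runs.loop (v := J)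
    (I := fun v σ' => ∃ j, j + v = J ∧ σ'.reg rX = p^[j + 1] q ∧
      LabelFront n Arc p (σ'.arr aOut) q (σ'.reg rX) ∧ σ'.reg rY = q ∧
      σ'.reg rT = n + 2 - σ'.reg rX ∧
      ∀ i : Fin n, ¬ Segment n p q (i + 2) → σ'.arr aOut i = σ.arr aOut i) ?_ ?_).mono
        (by gcongr) ?_)
  · refine ⟨0, by simp, ?_, ?_, ?_, ?_, ?_⟩
    · simp [sem, h.verts, ← hσq, hp.succ q hqd]
    · simp [sem, h.verts, ← hσq, hp.succ q hqd, LabelFront]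
    · simp [sem, h.verts, ← hσq]
    · simp [sem, h.verts]
    · simp [sem]
  · rintro v σ' ⟨j, hj, hX, hL, hY, hT, hO⟩ hF h0
    have h1 : σ'.reg 1 = 1 := (hF.1 1 rfl).trans (by simp [sem, h.one])
    have hV : σ'.reg rVerts = n + 2 := (hF.1 _ rfl).trans (by simp [sem, h.verts])
    have hS : σ'.arr aSucc = σ.arr aSucc := (hF.2 _ rfl).trans (by simp [sem])
    have hlt : σ'.reg rX < n + 2 := by omega
    have hv : v ≠ 0 := by
      rintro rfl
      rw [Nat.add_zero] at hj
      subst hj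
      rw [hX] at hlt
      omega
    have hSx : σ.arr aSucc (σ'.reg rX) = p (σ'.reg rX) := hp.succ _ (by omega)
    have hstep := hL.step hp.system hq hqd hlt
    have hseg := hL.segment hlt
    have h2 := hL.two_le hp.system hq
    refine Runs.of_sem rfl le_rfl ⟨v - 1, by omega, j + 1, by omega, ?_, ?_, ?_, ?_, ?_⟩
    · simp only [sem, State.setReg_reg, State.setArr_reg, State.setReg_arr, State.setArr_arr]
      rw [Function.iterate_succ_apply', ← hX]
      simp [hS, hSx]
    · simpa [sem, hS, hSx, h1, hY, Nat.sub_sub] using hstep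
    · simp [sem, hY]
    · simp [sem, hV]
    · intro i hi
      have : (i : ℕ) ≠ σ'.reg rX - 1 - 1 := by
        rintro e
        refine hi ?_
        rwa [e, Nat.sub_sub, Nat.sub_add_cancel h2]
      simp [sem, h1, this, hO i hi]
  · rintro σ' ⟨⟨v, j, -, -, hL, -, hT, hO⟩, h0⟩
    exact ⟨hL.winning hN hp.system hq hqd (by omega), hO⟩

theorem runs_labelPaths (hN : IsNetwork n Arc) {d : ℕ} {p : Equiv.Perm ℕ} {σ : State}
    (h : Holds n M Arc σ) (hp : HoldsPaths n Arc d p σ) (hdn : d ≤ 2 * n + 2) :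
    Runs labelPaths (1 + (n * ((3 + ((n + 2) * (5 + 1) + 1)) + 2) + 1)) (fun σ' =>
      ∀ q, n + 2 ≤ q → q < d → Winning Arc (labelled n p (σ'.arr aOut) q)) σ := by
  have hF₀ := Frame.sem (P := .sub rK rNext rVerts) rfl σ
  refine Runs.sem_seq rfl le_rfl ((Runs.countdown (m := d - (n + 2))
    (B := 3 + ((n + 2) * (5 + 1) + 1))
    (I := fun i σ' => ∀ q, n + 2 + i ≤ q → q < d → Winning Arc (labelled n p (σ'.arr aOut) q))
    ?_ ?_ ?_ rfl rfl ?_).mono ?_ ?_)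
  · simp [sem, h.one]
  · simp [sem, h.verts, hp.next]
  · intro q hq hqd
    omega
  · intro i hi σ' hF _ hI
    have hσ' := ((h.frame hF₀ rfl rfl).frame hF rfl rfl).frame (.setReg σ' rK i) rfl rfl
    have hp' := ((hp.frame hF₀ rfl rfl).frame hF rfl rfl).frame (.setReg σ' rK i) rfl rfl
    refine (runs_labelPath hN hσ' hp' (q := n + 2 + i) (by omega) (by omega)
      (by simp)).mono le_rfl ?_
    rintro σ'' ⟨hW, hO⟩ q hq hqd
    rcases hq.eq_or_lt with rfl | hlt
    · exact hW
    · -- the labels on the path of `q` have not been changed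
      refine (hI q (by omega) hqd).mono fun k hk => ?_
      rw [mem_labelled] at hk ⊢
      refine ⟨?_, hk.2⟩
      rw [hO k fun hs => hlt.ne (hs.unique (by omega) (by omega) hk.2)]
      exact hk.1
  · gcongr
    omega
  · intro σ' hI q hq hqd
    exact hI q (by omega) hqd

/-- The time bound for the augmenting path program. -/
def disjointPathsTime (n M : ℕ) : ℕ :=
  (2 + (((n + 2) * (1 + 2) + 1) + 2)) + (2 + ((n * (phaseTime n M + 2) + 1) +
    ((1 + (n * ((3 + ((n + 2) * (5 + 1) + 1)) + 2) + 1)) + 2)))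

theorem runs_disjointPaths (hN : IsNetwork n Arc) {σ : State} (h : Holds n M Arc σ)
    (hpar : ∀ y, σ.arr aPar y = 0) {g : CoalitionalGame n} (hg : IsGameOf g Arc) :
    Runs disjointPaths (disjointPathsTime n M) (fun σ' =>
      ∃ π : CoalitionStructure n, g.IsOptimal π ∧ Describes σ'.output π) σ := by
  refine Runs.seq_frame (runs_initPaths hN h) fun σ₁ hp₁ hF₁ => ?_
  have h₁ := h.frame hF₁ rfl rfl
  have hF₂ := Frame.sem (P := copy rP rPlayers) rfl σ₁
  refine Runs.sem_seq rfl le_rfl (Runs.seq_frame (Runs.countdown (m := n)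
    -- as long as every phase has succeeded, `d` counts the phases; once one has failed, the
    -- number of paths is a bound for the welfare
    (I := fun i σ' => (∀ y, n + 2 ≤ y → σ'.arr aPar y = 0) ∧ ∃ d p, HoldsPaths n Arc d p σ' ∧
      d + i ≤ 2 * n + 2 ∧ (d + i = 2 * n + 2 ∨ WelfareBound n Arc (d - (n + 2))))
    ?_ ?_ ?_ rfl rfl ?_) ?_)
  · simp [copy, sem, h₁.one]
  · simp [copy, sem, h₁.players]
  · refine ⟨fun y _ => ?_, n + 2, 1, hp₁.frame hF₂ rfl rfl, by omega, .inl (by omega)⟩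
    rw [hF₂.2 _ rfl, hF₁.2 _ rfl, hpar]
  · rintro i hi σ' hF _ ⟨hpar', d, p, hp, hd, hI⟩
    have hσ' := ((h₁.frame hF₂ rfl rfl).frame hF rfl rfl).frame (.setReg σ' rP i) rfl rfl
    refine (runs_phase hN hσ' (hp.frame (.setReg σ' rP i) rfl rfl) hpar').mono le_rfl ?_
    rintro σ'' ⟨hpar'', ⟨p', hp'⟩ | ⟨hp', hb⟩⟩
    · refine ⟨hpar'', d + 1, p', hp', by omega, hI.imp (by omega) fun hb g hg π => ?_⟩
      refine (hb g hg π).trans ?_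
      norm_cast
      omega
    · exact ⟨hpar'', d, p, hp', by omega, .inr hb⟩
  · rintro σ₃ ⟨-, d, p, hp₃, hd, hb⟩ hF₃
    have h₃ := (h₁.frame hF₂ rfl rfl).frame hF₃ rfl rfl
    refine Runs.seq_frame (runs_labelPaths hN h₃ hp₃ (by omega)) fun σ₄ hW hF₄ => ?_
    have h₄ := h₃.frame hF₄ rfl rfl
    have hout : ((copy rLen rPlayers).sem σ₄).output = (List.range n).map (σ₄.arr aOut) := by
      simp [State.output, copy, sem, h₄.players]
    refine Runs.of_sem rfl le_rfl ?_
    rw [hout]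
    refine hg.exists_isOptimal_describes _ (by simp) (Finset.Ico (n + 2) d) (fun π => ?_) ?_
    · rw [Nat.card_Ico]
      rcases hb with hb | hb
      · rw [show d - (n + 2) = n by omega]
        exact welfareBound_players g hg π
      · exact hb g hg π
    · intro q hq
      rw [Finset.mem_Ico] at hq
      refine (hW q hq.1 hq.2).mono fun i hi => ?_
      simpa using (mem_labelled.1 hi).1

/-! ### The two games as games of networks -/

/-- The vertices of a chain that starts in `a` are reached from `a` through allowed vertices. -/
theorem reflTransGen_of_isChain {α : Type*} {R : α → α → Prop} {ok : α → Prop} {b : α}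
    (l : List α) (a : α) (hl : (a :: l).IsChain R) (hb : (a :: l).getLast? = some b)
    (hok : ∀ x ∈ l, ok x) : Relation.ReflTransGen (fun x y => R x y ∧ ok y) a b := by
  induction l generalizing a with
  | nil =>
    obtain rfl : a = b := by simpa using hb
    exact .refl
  | cons c l ih =>
    rw [List.isChain_cons_cons] at hl
    refine .head ⟨hl.1, hok c (by simp)⟩ (ih c hl.2 ?_ fun x hx => hok x (by simp [hx]))
    simpa [List.getLast?_cons_cons] using hb

/-- A walk contains a path. -/
theorem exists_nodup_isChain {α : Type*} {R : α → α → Prop} {a b : α}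
    (h : Relation.ReflTransGen R a b) :
    ∃ l : List α, l.head? = some a ∧ l.getLast? = some b ∧ l.Nodup ∧ l.IsChain R ∧
      ∀ x ∈ l, x = a ∨ ∃ z, R z x := by
  induction h using Relation.ReflTransGen.head_induction_on with
  | refl => exact ⟨[b], by simp⟩
  | @head a c hac _ ih =>
    obtain ⟨l, hl, hlast, hnd, hch, hmem⟩ := ih
    have hmem' : ∀ x ∈ l, ∃ z, R z x := fun x hx => (hmem x hx).elim (fun e => e ▸ ⟨a, hac⟩) id
    by_cases ha : a ∈ l
    · obtain ⟨l₁, l₂, rfl⟩ := List.append_of_mem ha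
      refine ⟨a :: l₂, by simp, ?_, (List.nodup_append.1 hnd).2.1, hch.right_of_append, ?_⟩
      · simpa using hlast
      · exact fun x hx => .inr (hmem' x (List.mem_append_right _ hx))
    · refine ⟨a :: l, by simp, ?_, List.nodup_cons.2 ⟨ha, hnd⟩, ?_, ?_⟩
      · simp [List.getLast?_cons, hlast]
      · refine List.isChain_cons.2 ⟨fun y hy => ?_, hch⟩
        rw [hl] at hy
        obtain rfl : c = y := by simpa using hy
        exact hac
      · intro x hx
        rcases List.mem_cons.1 hx with rfl | hx
        · exact .inl rfl
        · exact .inr (hmem' x hx)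

theorem Vertex.code_lt {k : ℕ} (x : Vertex k) : x.code < k + 2 := by
  cases x <;> simp [Vertex.code]

theorem Vertex.code_injective {k : ℕ} : Function.Injective (Vertex.code (k := k)) := by
  intro x y h
  cases x <;> cases y <;> simp_all [Vertex.code, Fin.ext_iff]

theorem Vertex.code_eq_zero {k : ℕ} {x : Vertex k} : x.code = 0 ↔ x = .s :=
  Vertex.code_injective.eq_iff' rfl

theorem Vertex.code_eq_one {k : ℕ} {x : Vertex k} : x.code = 1 ↔ x = .t :=
  Vertex.code_injective.eq_iff' rfl

theorem Vertex.code_eq_add_two {k : ℕ} {x : Vertex k} {i : Fin k} : x.code = i + 2 ↔ x = .inner i :=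
  Vertex.code_injective.eq_iff' rfl

namespace STGraph

variable (G : STGraph)

/-- The edge `e` can be used to leave `x`. -/
def Starts (e : Fin G.numE) (x : Vertex G.numV) : Prop := ∃ y, G.Joins e x y

/-- The edge `e` can be used to enter `y`. -/
def Ends (e : Fin G.numE) (y : Vertex G.numV) : Prop := ∃ x, G.Joins e x y

variable {G}

theorem starts_iff {e : Fin G.numE} {x : Vertex G.numV} :
    G.Starts e x ↔ G.src e = x ∨ G.directed = false ∧ G.tgt e = x := by
  simp [Starts, Joins, exists_or]

theorem ends_iff {e : Fin G.numE} {y : Vertex G.numV} :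
    G.Ends e y ↔ G.tgt e = y ∨ G.directed = false ∧ G.src e = y := by
  simp [Ends, Joins, exists_or]

theorem joins_of_starts_of_ends {e : Fin G.numE} {x y : Vertex G.numV} (hx : G.Starts e x)
    (hy : G.Ends e y) : x = y ∨ G.Joins e x y := by
  rw [starts_iff] at hx
  rw [ends_iff] at hy
  unfold Joins
  rcases hx with rfl | ⟨h, rfl⟩ <;> rcases hy with rfl | ⟨h', rfl⟩ <;> simp_all

theorem edgesAdmitPath_iff {C : Finset (Fin G.numE)} :
    G.EdgesAdmitPath C ↔
      Relation.ReflTransGen (fun x y => ∃ e ∈ C, G.Joins e x y) Vertex.s Vertex.t := by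
  constructor
  · rintro ⟨_ | ⟨a, l⟩, h₁, h₂, -, h₄⟩
    · simp at h₁
    · obtain rfl : a = Vertex.s := by simpa using h₁
      exact Relation.ReflTransGen.mono (fun _ _ h => h.1) _ _
        (reflTransGen_of_isChain (ok := fun _ => True) l _ h₄ h₂ (by simp))
  · intro h
    obtain ⟨l, h₁, h₂, h₃, h₄, -⟩ := exists_nodup_isChain h
    exact ⟨l, h₁, h₂, h₃, h₄⟩

theorem verticesAdmitPath_iff {C : Finset (Fin G.numV)} :
    G.VerticesAdmitPath C ↔
      Relation.ReflTransGen (fun x y => (∃ e, G.Joins e x y) ∧ ∀ i, y = .inner i → i ∈ C)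
        Vertex.s Vertex.t := by
  constructor
  · rintro ⟨_ | ⟨a, l⟩, ⟨h₁, h₂, -, h₄⟩, hC⟩
    · simp at h₁
    · obtain rfl : a = Vertex.s := by simpa using h₁
      refine Relation.ReflTransGen.mono (fun x y h => ⟨?_, h.2⟩) _ _ (reflTransGen_of_isChain
        (ok := fun y => ∀ i, y = .inner i → i ∈ C) l _ h₄ h₂ ?_)
      · rintro x hx i rfl
        exact hC i (by simp [hx])
      · obtain ⟨⟨e, -, he⟩, -⟩ := h
        exact ⟨e, he⟩
  · intro h
    obtain ⟨l, h₁, h₂, h₃, h₄, h₅⟩ := exists_nodup_isChain h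
    refine ⟨l, ⟨h₁, h₂, h₃, h₄.imp fun x y h => ?_⟩, fun i hi => ?_⟩
    · obtain ⟨e, he⟩ := h.1
      exact ⟨e, Finset.mem_univ e, he⟩
    · rcases h₅ _ hi with h | ⟨z, -, hz⟩
      · cases h
      · exact hz i rfl

variable (G)

/-- The network of the vertex path game: the graph itself, in terms of the numbers of the
vertices, with a loop at each player. -/
def vertexArc (a b : ℕ) : Prop :=
  (∃ e x y, G.Joins e x y ∧ a = x.code ∧ b = y.code) ∨ a = b ∧ 2 ≤ a ∧ a < G.numV + 2

/-- The loop at the edge `e` in the line graph, and the arcs between `e` and the terminals. -/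
def terminalArc (e : Fin G.numE) (a b : ℕ) : Prop :=
  (a = e + 2 ∧ b = e + 2) ∨ (G.Starts e .s ∧ a = 0 ∧ b = e + 2) ∨ (G.Ends e .t ∧ a = e + 2 ∧ b = 1)

/-- The arc of the line graph from the edge `e` to the edge `f`, if these can be used in
succession. -/
def linkArc (e f : Fin G.numE) (a b : ℕ) : Prop :=
  (∃ y, G.Ends e y ∧ G.Starts f y) ∧ a = e + 2 ∧ b = f + 2

/-- The network of the edge path game: the line graph. -/
def edgeArc (a b : ℕ) : Prop :=
  ∃ e : Fin G.numE, G.terminalArc e a b ∨ ∃ f : Fin G.numE, G.linkArc e f a b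

variable {G}

theorem isNetwork_vertexArc (h : G.NoDirectEdge) : IsNetwork G.numV G.vertexArc where
  left_lt := by
    rintro a b (⟨e, x, y, -, rfl, rfl⟩ | h)
    · exact x.code_lt
    · exact h.2.2
  right_lt := by
    rintro a b (⟨e, x, y, -, rfl, rfl⟩ | ⟨rfl, h⟩)
    · exact y.code_lt
    · exact h.2
  self h₁ h₂ := .inr ⟨rfl, h₁, h₂⟩
  not_direct := by
    rintro (⟨e, x, y, he, hx, hy⟩ | h')
    · rw [Vertex.code_eq_zero.1 hx.symm, Vertex.code_eq_one.1 hy.symm] at he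
      exact h e he
    · omega

theorem isNetwork_edgeArc : IsNetwork G.numE G.edgeArc where
  left_lt := by
    rintro a b ⟨e, (h | h | h) | ⟨f, -, h⟩⟩ <;> omega
  right_lt := by
    rintro a b ⟨e, (h | h | h) | ⟨f, -, h⟩⟩ <;> omega
  self {x} h₁ h₂ := ⟨⟨x - 2, by omega⟩, .inl (.inl ⟨by simp; omega, by simp; omega⟩)⟩
  not_direct := by
    rintro ⟨e, (h | h | h) | ⟨f, -, h⟩⟩ <;> omega

theorem vertexArc_zero {x : Fin G.numV} : G.vertexArc 0 (x + 2) ↔ ∃ e, G.Joins e .s (.inner x) := by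
  constructor
  · rintro (⟨e, y, z, he, hy, hz⟩ | h)
    · rw [Vertex.code_eq_zero.1 hy.symm, Vertex.code_eq_add_two.1 hz.symm] at he
      exact ⟨e, he⟩
    · omega
  · rintro ⟨e, he⟩
    exact .inl ⟨e, _, _, he, rfl, rfl⟩

theorem vertexArc_one {x : Fin G.numV} : G.vertexArc (x + 2) 1 ↔ ∃ e, G.Joins e (.inner x) .t := by
  constructor
  · rintro (⟨e, y, z, he, hy, hz⟩ | h)
    · rw [Vertex.code_eq_add_two.1 hy.symm, Vertex.code_eq_one.1 hz.symm] at he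
      exact ⟨e, he⟩
    · omega
  · rintro ⟨e, he⟩
    exact .inl ⟨e, _, _, he, rfl, rfl⟩

theorem vertexArc_add_two {x y : Fin G.numV} :
    G.vertexArc (x + 2) (y + 2) ↔ x = y ∨ ∃ e, G.Joins e (.inner x) (.inner y) := by
  constructor
  · rintro (⟨e, u, v, he, hu, hv⟩ | h)
    · rw [Vertex.code_eq_add_two.1 hu.symm, Vertex.code_eq_add_two.1 hv.symm] at he
      exact .inr ⟨e, he⟩
    · exact .inl (by omega)
  · rintro (rfl | ⟨e, he⟩)
    · exact .inr ⟨rfl, by omega, by omega⟩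
    · exact .inl ⟨e, _, _, he, rfl, rfl⟩

theorem winning_vertexArc_iff (h : G.NoDirectEdge) {C : Finset (Fin G.numV)} :
    Winning G.vertexArc C ↔ G.VerticesAdmitPath C := by
  rw [verticesAdmitPath_iff]
  constructor
  · rintro ⟨x, hx, hx1⟩
    refine .tail (b := .inner x) ?_ ⟨vertexArc_one.1 hx1, by simp⟩
    clear hx1
    induction hx with
    | first hx h =>
      refine .single ⟨vertexArc_zero.1 h, ?_⟩
      rintro i ⟨⟩
      exact hx
    | next _ hy h ih =>
      rcases vertexArc_add_two.1 h with rfl | h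
      · exact ih
      · refine ih.tail ⟨h, ?_⟩
        rintro i ⟨⟩
        exact hy
  · intro hst
    suffices ∀ y, Relation.ReflTransGen (fun x y => (∃ e, G.Joins e x y) ∧
        ∀ i, y = .inner i → i ∈ C) Vertex.s y →
        Winning G.vertexArc C ∨ y = .s ∨ ∃ i, y = .inner i ∧ Reach G.vertexArc C i by
      simpa using this _ hst
    intro y hy
    induction hy with
    | refl => exact .inr (.inl rfl)
    | @tail y z _ hyz ih =>
      obtain ⟨⟨e, he⟩, hC⟩ := hyz
      rcases ih with hW | rfl | ⟨i, rfl, hi⟩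
      · exact .inl hW
      · cases z with
        | s => exact .inr (.inl rfl)
        | t => exact (h e he).elim
        | inner j => exact .inr (.inr ⟨j, rfl, .first (hC j rfl) (vertexArc_zero.2 ⟨e, he⟩)⟩)
      · cases z with
        | s => exact .inr (.inl rfl)
        | t => exact .inl ⟨i, hi, vertexArc_one.2 ⟨e, he⟩⟩
        | inner j =>
          exact .inr (.inr ⟨j, rfl, hi.next (hC j rfl) (vertexArc_add_two.2 (.inr ⟨e, he⟩))⟩)

theorem edgeArc_zero {f : Fin G.numE} : G.edgeArc 0 (f + 2) ↔ G.Starts f .s := by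
  constructor
  · rintro ⟨e, (h | ⟨h, -, h'⟩ | h) | ⟨f, -, h⟩⟩
    · omega
    · obtain rfl : f = e := by omega
      exact h
    · omega
    · omega
  · exact fun h => ⟨f, .inl (.inr (.inl ⟨h, rfl, rfl⟩))⟩

theorem edgeArc_one {f : Fin G.numE} : G.edgeArc (f + 2) 1 ↔ G.Ends f .t := by
  constructor
  · rintro ⟨e, (h | h | ⟨h, h', -⟩) | ⟨f, -, h⟩⟩
    · omega
    · omega
    · obtain rfl : f = e := by omega
      exact h
    · omega
  · exact fun h => ⟨f, .inl (.inr (.inr ⟨h, rfl, rfl⟩))⟩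

theorem edgeArc_add_two {e f : Fin G.numE} :
    G.edgeArc (e + 2) (f + 2) ↔ e = f ∨ ∃ y, G.Ends e y ∧ G.Starts f y := by
  constructor
  · rintro ⟨e', (h | h | h) | ⟨f', h, h', h''⟩⟩
    · exact .inl (by omega)
    · omega
    · omega
    · obtain rfl : e = e' := by omega
      obtain rfl : f = f' := by omega
      exact .inr h
  · rintro (rfl | h)
    · exact ⟨e, .inl (.inl ⟨rfl, rfl⟩)⟩
    · exact ⟨e, .inr ⟨f, h, rfl, rfl⟩⟩

theorem winning_edgeArc_iff {C : Finset (Fin G.numE)} :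
    Winning G.edgeArc C ↔ G.EdgesAdmitPath C := by
  rw [edgesAdmitPath_iff]
  constructor
  · rintro ⟨x, hx, hx1⟩
    suffices ∀ y, G.Ends x y →
        Relation.ReflTransGen (fun x y => ∃ e ∈ C, G.Joins e x y) Vertex.s y from
      this _ (edgeArc_one.1 hx1)
    clear hx1
    induction hx with
    | @first e he h =>
      intro y hy
      rcases joins_of_starts_of_ends (edgeArc_zero.1 h) hy with rfl | h
      · exact .refl
      · exact .single ⟨e, he, h⟩
    | @next e f _ hf h ih =>
      rcases edgeArc_add_two.1 h with rfl | ⟨z, hz, hz'⟩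
      · exact ih
      · intro y hy
        rcases joins_of_starts_of_ends hz' hy with rfl | h
        · exact ih _ hz
        · exact (ih _ hz).tail ⟨f, hf, h⟩
  · intro hst
    suffices ∀ y, Relation.ReflTransGen (fun x y => ∃ e ∈ C, G.Joins e x y) Vertex.s y →
        y = .s ∨ ∃ e, Reach G.edgeArc C e ∧ G.Ends e y by
      obtain h | ⟨e, he, he'⟩ := this _ hst
      · cases h
      · exact ⟨e, he, edgeArc_one.2 he'⟩
    intro y hy
    induction hy with
    | refl => exact .inl rfl
    | @tail y z _ hyz ih =>
      obtain ⟨f, hf, hj⟩ := hyz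
      rcases ih with rfl | ⟨e, he, hy⟩
      · exact .inr ⟨f, .first hf (edgeArc_zero.2 ⟨z, hj⟩), _, hj⟩
      · exact .inr ⟨f, he.next hf (edgeArc_add_two.2 (.inr ⟨y, hy, z, hj⟩)), y, hj⟩

theorem isGameOf_vertexPathGame (h : G.NoDirectEdge) :
    IsGameOf (G.vertexPathGame h) G.vertexArc :=
  fun _ => by classical exact if_congr (winning_vertexArc_iff h).symm rfl rfl

theorem isGameOf_edgePathGame : IsGameOf G.edgePathGame G.edgeArc :=
  fun _ => by classical exact if_congr winning_edgeArc_iff.symm rfl rfl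

/-! ### The input -/

theorem getD_flatten_pairs (l : List (ℕ × ℕ)) (i : ℕ) (hi : i < l.length) :
    (l.map fun u => [u.1, u.2]).flatten.getD (2 * i) 0 = l[i].1 ∧
      (l.map fun u => [u.1, u.2]).flatten.getD (2 * i + 1) 0 = l[i].2 := by
  induction l generalizing i with
  | nil => simp at hi
  | cons u l ih =>
    cases i with
    | zero => simp
    | succ i =>
      have := ih i (by simpa using hi)
      simpa [Nat.mul_add, Nat.add_right_comm _ 2 1] using this

theorem encode_directed : G.encode.getD 0 0 = if G.directed then 1 else 0 := rfl
theorem encode_numV : G.encode.getD 1 0 = G.numV := rfl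
theorem encode_numE : G.encode.getD 2 0 = G.numE := rfl

theorem encode_src_tgt (e : Fin G.numE) :
    G.encode.getD (e + e + 3) 0 = (G.src e).code ∧
      G.encode.getD (e + e + 3 + 1) 0 = (G.tgt e).code := by
  have h := getD_flatten_pairs (List.ofFn fun e => ((G.src e).code, (G.tgt e).code)) e (by simp)
  rw [List.map_ofFn] at h
  simp only [List.getElem_ofFn] at h
  rw [two_mul] at h
  exact h

end STGraph

/-! ### The programs that build the networks -/

/- The following registers stay unchanged while arcs are stored: whether the graph is directed, the
number of edges, the ends of two edges, the vertices of the network that stand for these edges, and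
the constants `0` and `1`. -/
local notation "rDir" => (13 : ℕ)
local notation "rEdges" => (14 : ℕ)
local notation "rSrc" => (15 : ℕ)
local notation "rTgt" => (16 : ℕ)
local notation "rSrc'" => (17 : ℕ)
local notation "rTgt'" => (18 : ℕ)
local notation "rU" => (19 : ℕ)
local notation "rW" => (20 : ℕ)
local notation "rZero" => (21 : ℕ)
local notation "rUnit" => (22 : ℕ)

/-- Store the arc from `u` to `w`. -/
def addArc (u w : ℕ) : Program :=
  .store aTail rArcs u ;; .store aHead rArcs w ;; .add rArcs rArcs rOne

/-- Store the arc from `u` to `w` if `x = y`. -/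
def addArcIf (x y u w : ℕ) : Program :=
  .sub rX x y ;; .sub rY y x ;; .add rX rX rY ;; .cond rX skip (addArc u w)

/-- Read the header of the input; the number of players stands at position `i`. -/
def readHeader (i : ℕ) : Program :=
  .const rX 0 ;; .load rDir aIn rX ;; .const rX i ;; .load rPlayers aIn rX ;;
  .const rX 2 ;; .load rEdges aIn rX ;; .add rVerts rPlayers rX ;;
  .const rOne 1 ;; .const rUnit 1 ;; .const rZero 0 ;; .const rArcs 0

/-- Read the ends of the edge number `k` from the input. -/
def readEdge (k u w : ℕ) : Program :=
  .add rX k k ;; .const rY 3 ;; .add rX rX rY ;; .load u aIn rX ;; .add rX rX rOne ;;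
  .load w aIn rX

/-- `u := k + 2` -/
def playerVertex (k u : ℕ) : Program := .const rX 2 ;; .add u k rX

/-- Store the arcs of the vertex path game that belong to the edge number `rK`. -/
def vertexGameEdge : Program :=
  readEdge rK rSrc rTgt ;; addArc rSrc rTgt ;; .cond rDir skip (addArc rTgt rSrc)

/-- Store the loop at the player number `rK`. -/
def vertexGameLoop : Program := playerVertex rK rU ;; addArc rU rU

def vertexGameArcs : Program :=
  copy rK rEdges ;; countdown rK vertexGameEdge ;;
  copy rK rPlayers ;; countdown rK vertexGameLoop

/-- The program for the vertex path game. -/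
def vertexGameProgram : Program := readHeader 1 ;; vertexGameArcs ;; disjointPaths

/-- Store the arcs `STGraph.terminalArc` of the edge number `rK`. -/
def edgeGameTerminals : Program :=
  (readEdge rK rSrc rTgt ;; playerVertex rK rU) ;; addArc rU rU ;;
  addArcIf rSrc rZero rZero rU ;; addArcIf rTgt rUnit rU rUnit ;;
  .cond rDir skip (addArcIf rTgt rZero rZero rU ;; addArcIf rSrc rUnit rU rUnit)

/-- Store the arc `STGraph.linkArc` from the edge last treated by `edgeGameTerminals` to the edge
number `rR`. -/
def edgeGamePair : Program :=
  (readEdge rR rSrc' rTgt' ;; playerVertex rR rW) ;; addArcIf rTgt rSrc' rU rW ;;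
  .cond rDir skip (addArcIf rTgt rTgt' rU rW ;; addArcIf rSrc rSrc' rU rW ;;
    addArcIf rSrc rTgt' rU rW)

def edgeGameEdge : Program :=
  edgeGameTerminals ;; copy rR rEdges ;; countdown rR edgeGamePair

def edgeGameArcs : Program := copy rK rEdges ;; countdown rK edgeGameEdge

/-- The program for the edge path game. -/
def edgeGameProgram : Program := readHeader 2 ;; edgeGameArcs ;; disjointPaths

/-! ### Correctness of the programs that build the networks -/

/-- The memory holds at most `c` arcs, which make up the relation `R`. -/
structure Stored (R : ℕ → ℕ → Prop) (c : ℕ) (σ : State) : Prop where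
  one : σ.reg rOne = 1
  le : σ.reg rArcs ≤ c
  mem : ∀ x y, R x y ↔ ∃ k < σ.reg rArcs, σ.arr aTail k = x ∧ σ.arr aHead k = y

namespace Stored

variable {R R' : ℕ → ℕ → Prop} {c c' : ℕ} {σ σ' : State} {P : Program}

theorem frame (h : Stored R c σ) (hF : Frame P σ σ')
    (hr : [1, 4].any P.writesReg = false) (ha : [2, 3].any P.writesArr = false) :
    Stored R c σ' := by
  simp only [List.any_cons, List.any_nil, Bool.or_false, Bool.or_eq_false_iff] at hr ha
  refine ⟨?_, ?_, ?_⟩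
  · rw [hF.1 _ hr.1, h.one]
  · rw [hF.1 _ hr.2]
    exact h.le
  · rw [hF.1 _ hr.2, hF.2 _ ha.1, hF.2 _ ha.2]
    exact h.mem

theorem congr (h : Stored R c σ) (hc : c ≤ c') (hR : ∀ x y, R' x y ↔ R x y) : Stored R' c' σ :=
  ⟨h.one, h.le.trans hc, fun x y => (hR x y).trans (h.mem x y)⟩

end Stored

/-- In addition, the registers from `rDir` on have the contents `ρ`. -/
def StoredAt (ρ : ℕ → ℕ) (R : ℕ → ℕ → Prop) (c : ℕ) (σ : State) : Prop :=
  Stored R c σ ∧ ∀ r, 13 ≤ r → σ.reg r = ρ r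

namespace StoredAt

variable {ρ : ℕ → ℕ} {R R' : ℕ → ℕ → Prop} {c c' : ℕ} {σ σ' : State} {P : Program}

theorem addArc (h : StoredAt ρ R c σ) {u w : ℕ} (hu : 13 ≤ u) (hw : 13 ≤ w) :
    StoredAt ρ (fun x y => R x y ∨ x = ρ u ∧ y = ρ w) (c + 1) ((addArc u w).sem σ) := by
  have hu' : σ.reg u = ρ u := h.2 u hu
  have hw' : σ.reg w = ρ w := h.2 w hw
  refine ⟨⟨?_, ?_, fun x y => ?_⟩, fun r hr => ?_⟩
  · simp [OptCS.addArc, sem, h.1.one]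
  · simpa [OptCS.addArc, sem, h.1.one] using h.1.le
  · rw [h.1.mem]
    simp only [OptCS.addArc, sem, State.setReg_reg, State.setArr_reg, State.setReg_arr,
      State.setArr_arr, h.1.one, hu', hw', if_pos, Nat.lt_succ_iff_lt_or_eq, or_and_right,
      exists_or, exists_eq_left, Function.update_self, Nat.reduceEqDiff, if_false]
    refine or_congr (exists_congr fun k => and_congr_right fun hk => ?_)
      (and_congr eq_comm eq_comm)
    rw [Function.update_of_ne hk.ne, Function.update_of_ne hk.ne]
  · have : r ≠ 4 := by omega
    simpa [OptCS.addArc, sem, this] using h.2 r hr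

theorem congr (h : StoredAt ρ R c σ) (hc : c ≤ c') (hR : ∀ x y, R' x y ↔ R x y) :
    StoredAt ρ R' c' σ :=
  ⟨h.1.congr hc hR, h.2⟩

theorem skip (h : StoredAt ρ R c σ) : StoredAt ρ R c (skip.sem σ) := by
  refine ⟨h.1.frame (Frame.sem (P := OptCS.skip) rfl σ) rfl rfl, fun r hr => ?_⟩
  have : r ≠ 12 := by omega
  simpa [OptCS.skip, sem, this] using h.2 r hr

theorem addArcIf (h : StoredAt ρ R c σ) {a b u w : ℕ} (ha : 13 ≤ a) (hb : 13 ≤ b)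
    (hu : 13 ≤ u) (hw : 13 ≤ w) :
    StoredAt ρ (fun x y => R x y ∨ ρ a = ρ b ∧ x = ρ u ∧ y = ρ w) (c + 1)
      ((addArcIf a b u w).sem σ) := by
  let P₀ : Program := .sub rX a b ;; .sub rY b a ;; .add rX rX rY
  have h₀ : StoredAt ρ R c (P₀.sem σ) := by
    refine ⟨h.1.frame (Frame.sem (P := P₀) rfl σ) rfl rfl, fun r hr => ?_⟩
    have h9 : r ≠ 9 := by omega
    have h10 : r ≠ 10 := by omega
    simpa [P₀, sem, h9, h10] using h.2 r hr
  have hX : (P₀.sem σ).reg rX = (ρ a - ρ b) + (ρ b - ρ a) := by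
    have h9 : a ≠ 9 := by omega
    have h9' : b ≠ 9 := by omega
    simp [P₀, sem, h9, h9', h.2 a ha, h.2 b hb]
  have hsem : (OptCS.addArcIf a b u w).sem σ =
      if (P₀.sem σ).reg rX = 0 then (OptCS.addArc u w).sem (P₀.sem σ)
      else OptCS.skip.sem (P₀.sem σ) := rfl
  rw [hsem, hX]
  split_ifs with h0
  · have hab : ρ a = ρ b := by omega
    exact (h₀.addArc hu hw).congr le_rfl fun x y => by simp [hab]
  · have hab : ρ a ≠ ρ b := by omega
    exact h₀.skip.congr (Nat.le_succ c) fun x y => by simp [hab]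

theorem cond {x : ℕ} (hx : σ.reg x = ρ x) (hP : ρ x = 0 → StoredAt ρ R c (P.sem σ))
    (hP' : ρ x ≠ 0 → StoredAt ρ R c σ) : StoredAt ρ R c (sem (.cond x OptCS.skip P) σ) := by
  simp only [sem, hx]
  split_ifs with h0
  · exact hP h0
  · exact (hP' h0).skip

end StoredAt

/-- The memory holds the input `G` and its header, and no search forest. -/
structure HoldsInput (G : STGraph) (n : ℕ) (σ : State) : Prop where
  players : σ.reg rPlayers = n
  verts : σ.reg rVerts = n + 2
  dir : σ.reg rDir = if G.directed then 1 else 0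
  edges : σ.reg rEdges = G.numE
  zero : σ.reg rZero = 0
  unit : σ.reg rUnit = 1
  input : σ.arr aIn = fun i => G.encode.getD i 0
  par : ∀ y, σ.arr aPar y = 0

theorem HoldsInput.frame {G : STGraph} {P : Program} {σ σ' : State} (h : HoldsInput G n σ)
    (hF : Frame P σ σ') (hr : [2, 3, 13, 14, 21, 22].any P.writesReg = false)
    (ha : [0, 5].any P.writesArr = false) : HoldsInput G n σ' := by
  simp only [List.any_cons, List.any_nil, Bool.or_false, Bool.or_eq_false_iff] at hr ha
  refine ⟨?_, ?_, ?_, ?_, ?_, ?_, ?_, ?_⟩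
  · rw [hF.1 _ hr.1, h.players]
  · rw [hF.1 _ hr.2.1, h.verts]
  · rw [hF.1 _ hr.2.2.1, h.dir]
  · rw [hF.1 _ hr.2.2.2.1, h.edges]
  · rw [hF.1 _ hr.2.2.2.2.1, h.zero]
  · rw [hF.1 _ hr.2.2.2.2.2, h.unit]
  · rw [hF.2 _ ha.1, h.input]
  · rw [hF.2 _ ha.2]
    exact h.par

theorem readHeader_sem (G : STGraph) (i : ℕ) :
    HoldsInput G (G.encode.getD i 0) ((readHeader i).sem (inputState G.encode)) ∧
      Stored (fun _ _ => False) 0 ((readHeader i).sem (inputState G.encode)) := by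
  refine ⟨⟨?_, ?_, ?_, ?_, ?_, ?_, ?_, ?_⟩, ⟨?_, ?_, ?_⟩⟩
  all_goals simp only [readHeader, sem, inputState, State.setReg_reg, State.setReg_arr]
  all_goals simp [STGraph.encode_directed, STGraph.encode_numE, -List.getD_eq_getElem?_getD]

theorem Stored.holds {c : ℕ} {G : STGraph} {σ : State} (h : Stored Arc c σ)
    (hI : HoldsInput G n σ) : ∃ M ≤ c, Holds n M Arc σ :=
  ⟨_, h.le, h.one, hI.players, hI.verts, rfl, h.mem⟩

theorem exists_fin_le_iff {m i : ℕ} (hi : i < m) (Q : Fin m → Prop) :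
    (∃ e : Fin m, i ≤ e ∧ Q e) ↔ (∃ e : Fin m, i + 1 ≤ e ∧ Q e) ∨ Q ⟨i, hi⟩ := by
  constructor
  · rintro ⟨e, he, hQ⟩
    rcases he.eq_or_lt with rfl | hlt
    · exact .inr hQ
    · exact .inl ⟨e, hlt, hQ⟩
  · rintro (⟨e, he, hQ⟩ | hQ)
    · exact ⟨e, (Nat.le_succ i).trans he, hQ⟩
    · exact ⟨_, le_rfl, hQ⟩

variable {G : STGraph}

theorem readEdge_sem {σ : State} (hI : HoldsInput G n σ) (h1 : σ.reg rOne = 1) {k u w : ℕ}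
    {e : Fin G.numE} (hk : σ.reg k = e) (hu : 13 ≤ u) (hw : 13 ≤ w) (huw : u ≠ w) :
    ((readEdge k u w).sem σ).reg u = (G.src e).code ∧
      ((readEdge k u w).sem σ).reg w = (G.tgt e).code := by
  have h9 : u ≠ 9 := by omega
  have h9' : w ≠ 9 := by omega
  have hu1 : 1 ≠ u := by omega
  have hu9 : 9 ≠ u := by omega
  have h := G.encode_src_tgt e
  simpa [readEdge, sem, hk, h9, huw, hu9, hu1, h1, hI.input, -List.getD_eq_getElem?_getD] using h

theorem playerVertex_sem {σ : State} {k u : ℕ} (hk : k ≠ 9) :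
    ((playerVertex k u).sem σ).reg u = σ.reg k + 2 := by
  simp [playerVertex, sem, hk]

theorem sem_seq (P Q : Program) (σ : State) : (P ;; Q).sem σ = Q.sem (P.sem σ) := rfl

theorem stored_vertexGameEdge {R : ℕ → ℕ → Prop} {c : ℕ} {σ : State} (hI : HoldsInput G n σ)
    (hS : Stored R c σ) {e : Fin G.numE} (hk : σ.reg rK = e) :
    Stored (fun a b => R a b ∨ ∃ x y, G.Joins e x y ∧ a = x.code ∧ b = y.code) (c + 2)
      (vertexGameEdge.sem σ) := by
  obtain ⟨hu, hw⟩ := readEdge_sem hI hS.one (u := rSrc) (w := rTgt) hk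
    (by decide) (by decide) (by decide)
  have hF := Frame.sem (P := readEdge rK rSrc rTgt) rfl σ
  have hd := (hI.frame hF rfl rfl).dir
  have h₀ : StoredAt ((readEdge rK rSrc rTgt).sem σ).reg R c ((readEdge rK rSrc rTgt).sem σ) :=
    ⟨hS.frame hF rfl rfl, fun _ _ => rfl⟩
  have h₁ := h₀.addArc (u := rSrc) (w := rTgt) (by decide) (by decide)
  simp only [vertexGameEdge, sem_seq]
  refine (StoredAt.cond (h₁.2 _ (by decide)) (fun h0 => ?_) (fun h0 => ?_)).1
  · rw [hd] at h0
    refine (h₁.addArc (u := rTgt) (w := rSrc) (by decide) (by decide)).congr le_rfl fun a b => ?_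
    have : G.directed = false := by simpa using h0
    simp only [hu, hw, STGraph.Joins, this]
    constructor
    · rintro (h | ⟨x, y, ⟨rfl, rfl⟩ | ⟨-, rfl, rfl⟩, h⟩) <;> tauto
    · rintro ((h | h) | h)
      · exact .inl h
      · exact .inr ⟨_, _, .inl ⟨rfl, rfl⟩, h⟩
      · exact .inr ⟨_, _, .inr ⟨trivial, rfl, rfl⟩, h⟩
  · rw [hd] at h0
    refine h₁.congr (Nat.le_succ _) fun a b => ?_
    have : G.directed = true := by simpa using h0
    simp only [hu, hw, STGraph.Joins, this]
    constructor
    · rintro (h | ⟨x, y, ⟨rfl, rfl⟩ | ⟨h, -⟩, h⟩) <;> tauto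
    · rintro (h | h)
      · exact .inl h
      · exact .inr ⟨_, _, .inl ⟨rfl, rfl⟩, h⟩

theorem stored_vertexGameLoop {R : ℕ → ℕ → Prop} {c : ℕ} {σ : State}
    (hS : Stored R c σ) : Stored (fun a b => R a b ∨ a = σ.reg rK + 2 ∧ b = σ.reg rK + 2) (c + 1)
      (vertexGameLoop.sem σ) := by
  have hF := Frame.sem (P := playerVertex rK rU) rfl σ
  have h₀ : StoredAt ((playerVertex rK rU).sem σ).reg R c ((playerVertex rK rU).sem σ) :=
    ⟨hS.frame hF rfl rfl, fun _ _ => rfl⟩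
  refine (h₀.addArc (u := rU) (w := rU) (by decide) (by decide)).1.congr le_rfl fun a b => ?_
  rw [playerVertex_sem (by decide)]

theorem stored_edgeGameTerminals {R : ℕ → ℕ → Prop} {c : ℕ} {σ : State} (hI : HoldsInput G n σ)
    (hS : Stored R c σ) {e : Fin G.numE} (hk : σ.reg rK = e) :
    ∃ ρ : ℕ → ℕ, (ρ rSrc = (G.src e).code ∧ ρ rTgt = (G.tgt e).code ∧ ρ rU = e + 2) ∧
      StoredAt ρ (fun a b => R a b ∨ G.terminalArc e a b) (c + 5) (edgeGameTerminals.sem σ) := by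
  obtain ⟨hu, hw⟩ := readEdge_sem hI hS.one (u := rSrc) (w := rTgt) hk
    (by decide) (by decide) (by decide)
  have hF₁ := Frame.sem (P := readEdge rK rSrc rTgt) rfl σ
  have hF₂ := Frame.sem (P := playerVertex rK rU) rfl ((readEdge rK rSrc rTgt).sem σ)
  have hI₂ := (hI.frame hF₁ rfl rfl).frame hF₂ rfl rfl
  have hU := playerVertex_sem (σ := (readEdge rK rSrc rTgt).sem σ) (k := rK) (u := rU) (by decide)
  rw [hF₁.1 rK rfl, hk] at hU
  rw [← hF₂.1 _ rfl] at hu hw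
  have h₀ : StoredAt ((playerVertex rK rU).sem ((readEdge rK rSrc rTgt).sem σ)).reg R c
      ((playerVertex rK rU).sem ((readEdge rK rSrc rTgt).sem σ)) :=
    ⟨(hS.frame hF₁ rfl rfl).frame hF₂ rfl rfl, fun _ _ => rfl⟩
  refine ⟨_, ⟨hu, hw, hU⟩, ?_⟩
  have h₃ := ((h₀.addArc (u := rU) (w := rU) (by decide) (by decide)).addArcIf
    (a := rSrc) (b := rZero) (u := rZero) (w := rU)
    (by decide) (by decide) (by decide) (by decide)).addArcIf
    (a := rTgt) (b := rUnit) (u := rU) (w := rUnit)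
    (by decide) (by decide) (by decide) (by decide)
  simp only [edgeGameTerminals, sem_seq]
  refine StoredAt.cond (h₃.2 _ (by decide)) (fun h0 => ?_) (fun h0 => ?_)
  · rw [hI₂.dir] at h0
    have : G.directed = false := by simpa using h0
    refine ((h₃.addArcIf (a := rTgt) (b := rZero) (u := rZero) (w := rU)
      (by decide) (by decide) (by decide) (by decide)).addArcIf
      (a := rSrc) (b := rUnit) (u := rU) (w := rUnit)
      (by decide) (by decide) (by decide) (by decide)).congr le_rfl fun a b => ?_
    simp only [hu, hw, hU, hI₂.zero, hI₂.unit, Vertex.code_eq_zero, Vertex.code_eq_one,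
      STGraph.terminalArc, STGraph.starts_iff, STGraph.ends_iff, this]
    tauto
  · rw [hI₂.dir] at h0
    have : G.directed = true := by simpa using h0
    refine h₃.congr (by omega) fun a b => ?_
    simp only [hu, hw, hU, hI₂.zero, hI₂.unit, Vertex.code_eq_zero, Vertex.code_eq_one,
      STGraph.terminalArc, STGraph.starts_iff, STGraph.ends_iff, this]
    tauto

theorem STGraph.link_iff {e f : Fin G.numE} : (∃ y, G.Ends e y ∧ G.Starts f y) ↔
    (G.tgt e).code = (G.src f).code ∨ G.directed = false ∧ ((G.tgt e).code = (G.tgt f).code ∨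
      (G.src e).code = (G.src f).code ∨ (G.src e).code = (G.tgt f).code) := by
  simp only [STGraph.ends_iff, STGraph.starts_iff, Vertex.code_injective.eq_iff]
  constructor
  · rintro ⟨y, rfl | ⟨h, rfl⟩, h' | ⟨h', h''⟩⟩ <;> simp_all
  · rintro (h | ⟨h, h' | h' | h'⟩)
    · exact ⟨_, .inl h, .inl rfl⟩
    · exact ⟨_, .inl h', .inr ⟨h, rfl⟩⟩
    · exact ⟨_, .inr ⟨h, h'⟩, .inl rfl⟩
    · exact ⟨_, .inr ⟨h, h'⟩, .inr ⟨h, rfl⟩⟩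

theorem stored_edgeGamePair {R : ℕ → ℕ → Prop} {c : ℕ} {σ : State} (hI : HoldsInput G n σ)
    (hS : Stored R c σ) {e f : Fin G.numE} (he : σ.reg rSrc = (G.src e).code ∧
      σ.reg rTgt = (G.tgt e).code ∧ σ.reg rU = e + 2) (hk : σ.reg rR = f) :
    Stored (fun a b => R a b ∨ G.linkArc e f a b) (c + 4) (edgeGamePair.sem σ) := by
  obtain ⟨hu, hw⟩ := readEdge_sem hI hS.one (u := rSrc') (w := rTgt') hk
    (by decide) (by decide) (by decide)
  have hF₁ := Frame.sem (P := readEdge rR rSrc' rTgt') rfl σ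
  have hF₂ := Frame.sem (P := playerVertex rR rW) rfl ((readEdge rR rSrc' rTgt').sem σ)
  have hI₂ := (hI.frame hF₁ rfl rfl).frame hF₂ rfl rfl
  have hU := playerVertex_sem (σ := (readEdge rR rSrc' rTgt').sem σ) (k := rR) (u := rW)
    (by decide)
  rw [hF₁.1 rR rfl, hk] at hU
  rw [← hF₂.1 _ rfl] at hu hw
  rw [← hF₁.1 _ rfl, ← hF₁.1 _ rfl, ← hF₁.1 _ rfl, ← hF₂.1 _ rfl, ← hF₂.1 _ rfl,
    ← hF₂.1 _ rfl] at he
  have h₀ : StoredAt ((playerVertex rR rW).sem ((readEdge rR rSrc' rTgt').sem σ)).reg R c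
      ((playerVertex rR rW).sem ((readEdge rR rSrc' rTgt').sem σ)) :=
    ⟨(hS.frame hF₁ rfl rfl).frame hF₂ rfl rfl, fun _ _ => rfl⟩
  have h₁ := h₀.addArcIf (a := rTgt) (b := rSrc') (u := rU) (w := rW)
    (by decide) (by decide) (by decide) (by decide)
  simp only [edgeGamePair, sem_seq]
  refine (StoredAt.cond (h₁.2 _ (by decide)) (fun h0 => ?_) (fun h0 => ?_)).1
  · rw [hI₂.dir] at h0
    have : G.directed = false := by simpa using h0
    refine (((h₁.addArcIf (a := rTgt) (b := rTgt') (u := rU) (w := rW)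
      (by decide) (by decide) (by decide) (by decide)).addArcIf
      (a := rSrc) (b := rSrc') (u := rU) (w := rW)
      (by decide) (by decide) (by decide) (by decide)).addArcIf
      (a := rSrc) (b := rTgt') (u := rU) (w := rW)
      (by decide) (by decide) (by decide) (by decide)).congr le_rfl fun a b => ?_
    simp only [hu, hw, hU, he, STGraph.linkArc, STGraph.link_iff, this]
    tauto
  · rw [hI₂.dir] at h0
    have : G.directed = true := by simpa using h0
    refine h₁.congr (by omega) fun a b => ?_
    simp only [hu, hU, he, STGraph.linkArc, STGraph.link_iff, this]
    tauto

theorem runs_vertexGameArcs {σ : State} (hI : HoldsInput G G.numV σ)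
    (hS : Stored (fun _ _ => False) 0 σ) :
    Runs vertexGameArcs (2 + ((G.numE * (13 + 2) + 1) + (2 + (G.numV * (5 + 2) + 1))))
      (Stored G.vertexArc (2 * G.numE + G.numV)) σ := by
  have hF₁ := Frame.sem (P := copy rK rEdges) rfl σ
  have hI₁ := hI.frame hF₁ rfl rfl
  have hS₁ := hS.frame hF₁ rfl rfl
  refine Runs.sem_seq rfl le_rfl (Runs.seq_frame (Runs.countdown (m := G.numE)
    (I := fun i σ' => Stored (fun a b => ∃ e : Fin G.numE, i ≤ e ∧
      ∃ x y, G.Joins e x y ∧ a = x.code ∧ b = y.code) (2 * (G.numE - i)) σ')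
    hS₁.one ?_ ?_ rfl rfl ?_) ?_)
  · simp [copy, sem, hI.edges]
  · refine hS₁.congr (Nat.zero_le _) fun a b => ?_
    simp only [iff_false]
    rintro ⟨e, he, -⟩
    omega
  · intro i hi σ' hF _ hS'
    have hF' := Frame.setReg σ' rK i
    refine Runs.of_sem rfl (by decide) ((stored_vertexGameEdge (e := ⟨i, hi⟩)
      ((hI₁.frame hF rfl rfl).frame hF' rfl rfl) (hS'.frame hF' rfl rfl) (by simp)).congr
      (by omega) fun a b => exists_fin_le_iff hi _)
  · intro σ₂ hS₂ hF₂
    have hF₃ := Frame.sem (P := copy rK rPlayers) rfl σ₂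
    have hI₃ := (hI₁.frame hF₂ rfl rfl).frame hF₃ rfl rfl
    have hS₃ := hS₂.frame hF₃ rfl rfl
    refine Runs.sem_seq rfl le_rfl ((Runs.countdown (m := G.numV)
      (I := fun i σ' => Stored (fun a b => (∃ e x y, G.Joins e x y ∧ a = x.code ∧ b = y.code) ∨
        ∃ v : Fin G.numV, i ≤ v ∧ a = v + 2 ∧ b = v + 2) (2 * G.numE + (G.numV - i)) σ')
      hS₃.one ?_ ?_ rfl rfl ?_).mono le_rfl ?_)
    · simp [copy, sem, (hI₁.frame hF₂ rfl rfl).players]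
    · refine hS₃.congr (by omega) fun a b => ?_
      have : ¬ ∃ v : Fin G.numV, G.numV ≤ v ∧ a = v + 2 ∧ b = v + 2 := by
        rintro ⟨v, hv, -⟩
        omega
      simp [this]
    · intro i hi σ' hF _ hS'
      have hF' := Frame.setReg σ' rK i
      refine Runs.of_sem rfl (by decide) ((stored_vertexGameLoop (hS'.frame hF' rfl rfl)).congr
        (by omega) fun a b => ?_)
      rw [exists_fin_le_iff hi, or_assoc]
      simp
    · refine fun σ' hS' => hS'.congr (by omega) fun a b => or_congr_right ⟨?_, ?_⟩
      · rintro ⟨rfl, h₁, h₂⟩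
        exact ⟨⟨a - 2, by omega⟩, Nat.zero_le _, by simp; omega, by simp; omega⟩
      · rintro ⟨v, -, rfl, rfl⟩
        omega

theorem runs_edgeGameEdge {R : ℕ → ℕ → Prop} {c : ℕ} {σ : State} (hI : HoldsInput G n σ)
    (hS : Stored R c σ) {e : Fin G.numE} (hk : σ.reg rK = e) :
    Runs edgeGameEdge (40 + (2 + (G.numE * (37 + 2) + 1)))
      (Stored (fun a b => R a b ∨ G.terminalArc e a b ∨ ∃ f, G.linkArc e f a b)
        (c + 5 + 4 * G.numE)) σ := by
  obtain ⟨ρ, hρ, hS₁, hσ⟩ := stored_edgeGameTerminals hI hS hk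
  rw [← hσ _ (by decide), ← hσ _ (by decide), ← hσ _ (by decide)] at hρ
  have hI₁ := hI.frame (Frame.sem (P := edgeGameTerminals) rfl σ) rfl rfl
  refine Runs.sem_seq rfl (by decide) ?_
  generalize edgeGameTerminals.sem σ = σ₁ at *
  have hF₂ := Frame.sem (P := copy rR rEdges) rfl σ₁
  have hI₂ := hI₁.frame hF₂ rfl rfl
  have hS₂ := hS₁.frame hF₂ rfl rfl
  rw [← hF₂.1 _ rfl, ← hF₂.1 _ rfl, ← hF₂.1 _ rfl] at hρ
  refine Runs.sem_seq rfl le_rfl ((Runs.countdown (m := G.numE)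
    (I := fun i σ' => Stored (fun a b => (R a b ∨ G.terminalArc e a b) ∨
      ∃ f : Fin G.numE, i ≤ f ∧ G.linkArc e f a b) (c + 5 + 4 * (G.numE - i)) σ')
    hS₂.one ?_ ?_ rfl rfl ?_).mono le_rfl ?_)
  · simp [copy, sem, hI₁.edges]
  · refine hS₂.congr (by omega) fun a b => ?_
    have : ¬ ∃ f : Fin G.numE, G.numE ≤ f ∧ G.linkArc e f a b := by
      rintro ⟨f, hf, -⟩
      omega
    simp [this]
  · intro i hi σ' hF _ hS'
    have hF' := Frame.setReg σ' rR i
    have hρ' := hρ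
    rw [← hF.1 _ rfl, ← hF.1 _ rfl, ← hF.1 _ rfl, ← hF'.1 _ rfl, ← hF'.1 _ rfl,
      ← hF'.1 _ rfl] at hρ'
    refine Runs.of_sem rfl (by decide) ((stored_edgeGamePair (f := ⟨i, hi⟩)
      ((hI₂.frame hF rfl rfl).frame hF' rfl rfl) (hS'.frame hF' rfl rfl) hρ' (by simp)).congr
      (by omega) fun a b => ?_)
    rw [exists_fin_le_iff hi, or_assoc (c := G.linkArc _ _ _ _)]
  · refine fun σ' hS' => hS'.congr (by omega) fun a b => ?_
    simp [or_assoc]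

theorem runs_edgeGameArcs {σ : State} (hI : HoldsInput G n σ)
    (hS : Stored (fun _ _ => False) 0 σ) :
    Runs edgeGameArcs (2 + (G.numE * ((40 + (2 + (G.numE * (37 + 2) + 1))) + 2) + 1))
      (Stored G.edgeArc (G.numE * (5 + 4 * G.numE))) σ := by
  have hF₁ := Frame.sem (P := copy rK rEdges) rfl σ
  have hI₁ := hI.frame hF₁ rfl rfl
  have hS₁ := hS.frame hF₁ rfl rfl
  refine Runs.sem_seq rfl le_rfl ((Runs.countdown (m := G.numE)
    (I := fun i σ' => Stored (fun a b => ∃ e : Fin G.numE, i ≤ e ∧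
      (G.terminalArc e a b ∨ ∃ f : Fin G.numE, G.linkArc e f a b))
        ((G.numE - i) * (5 + 4 * G.numE)) σ')
    hS₁.one ?_ ?_ rfl rfl ?_).mono le_rfl ?_)
  · simp [copy, sem, hI.edges]
  · refine hS₁.congr (Nat.zero_le _) fun a b => ?_
    simp only [iff_false]
    rintro ⟨e, he, -⟩
    omega
  · intro i hi σ' hF _ hS'
    have hF' := Frame.setReg σ' rK i
    refine (runs_edgeGameEdge (e := ⟨i, hi⟩) ((hI₁.frame hF rfl rfl).frame hF' rfl rfl)
      (hS'.frame hF' rfl rfl) (by simp)).mono le_rfl fun σ'' hS'' => hS''.congr ?_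
        fun a b => exists_fin_le_iff hi _
    rw [show G.numE - i = G.numE - (i + 1) + 1 by omega, Nat.add_mul, one_mul, Nat.add_assoc]
  · exact fun σ' hS' => hS'.congr le_rfl fun a b => by simp [STGraph.edgeArc]

/-! ### Polynomial time -/

theorem disjointPathsTime_mono {n n' M M' : ℕ} (hn : n ≤ n') (hM : M ≤ M') :
    disjointPathsTime n M ≤ disjointPathsTime n' M' := by
  unfold disjointPathsTime phaseTime
  gcongr

/-- A program that reads the header, then builds the network of the game, and
then finds disjoint paths in it, solves the game. -/
theorem exists_exec {G : STGraph} {i n c B : ℕ} {P : Program} {g : CoalitionalGame n}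
    (hN : IsNetwork n Arc) (hg : IsGameOf g Arc) (hn : G.encode.getD i 0 = n)
    (hP : ∀ σ, HoldsInput G n σ → Stored (fun _ _ => False) 0 σ → Runs P B (Stored Arc c) σ)
    (hr : [2, 3, 13, 14, 21, 22].any P.writesReg = false)
    (ha : [0, 5].any P.writesArr = false) :
    ∃ (σ : State) (T : ℕ), Exec (readHeader i ;; P ;; disjointPaths) (inputState G.encode) σ T ∧
      T ≤ 11 + (B + disjointPathsTime n c) ∧
        ∃ π : CoalitionStructure n, g.IsOptimal π ∧ Describes σ.output π := by
  obtain ⟨hI, hS⟩ := readHeader_sem G i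
  rw [hn] at hI
  refine Runs.sem_seq rfl le_rfl (Runs.seq_frame (hP _ hI hS) fun σ' hS' hF => ?_)
  have hI' := hI.frame hF hr ha
  obtain ⟨M, hM, h⟩ := hS'.holds hI'
  exact (runs_disjointPaths hN h hI'.par hg).mono (disjointPathsTime_mono le_rfl hM) fun _ h => h

theorem exists_eval_eq_disjointPathsTime (N M : Polynomial ℕ) :
    ∃ p : Polynomial ℕ, ∀ s, p.eval s = disjointPathsTime (N.eval s) (M.eval s) := by
  let q : Polynomial ℕ :=
    ((2 + (((N + 2) * (2 + 2) + 1) + 2)) + (2 + ((N + 2) * ((2 + (M * (9 + 2) + 1)) + 2) + 1))) +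
      (1 + ((6 + (((N + 2) * (6 + 1) + 1) + 2)) + 1))
  refine ⟨(2 + (((N + 2) * (1 + 2) + 1) + 2)) + (2 + ((N * (q + 2) + 1) +
    ((1 + (N * ((3 + ((N + 2) * (5 + 1) + 1)) + 2) + 1)) + 2))), fun s => ?_⟩
  simp [disjointPathsTime, phaseTime, q]

theorem optCSInPolyTime_edgePathGame :
    OptCSInPolyTime STGraph.encode STGraph.size STGraph.numE (fun G => G.edgePathGame) := by
  obtain ⟨p, hp⟩ := exists_eval_eq_disjointPathsTime .X (.X * (5 + 4 * .X))
  refine ⟨edgeGameProgram,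
    11 + ((2 + (.X * ((40 + (2 + (.X * (37 + 2) + 1))) + 2) + 1)) + p), fun G => ?_⟩
  obtain ⟨σ, T, hE, hT, hπ⟩ := exists_exec (P := edgeGameArcs) STGraph.isNetwork_edgeArc
    STGraph.isGameOf_edgePathGame (STGraph.encode_numE (G := G))
    (fun σ hI hS => runs_edgeGameArcs hI hS) rfl rfl
  refine ⟨σ, T, hE, hT.trans ?_, hπ⟩
  have hm : G.numE ≤ G.size := Nat.le_add_left _ _
  simp only [Polynomial.eval_add, Polynomial.eval_mul, Polynomial.eval_X, Polynomial.eval_one,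
    Polynomial.eval_ofNat, hp]
  gcongr
  exact disjointPathsTime_mono hm (by gcongr)

theorem optCSInPolyTime_vertexPathGame :
    OptCSInPolyTime (fun G : {G : STGraph // G.NoDirectEdge} => G.1.encode) (fun G => G.1.size)
      (fun G => G.1.numV) (fun G => G.1.vertexPathGame G.2) := by
  obtain ⟨p, hp⟩ := exists_eval_eq_disjointPathsTime .X (2 * .X + .X)
  refine ⟨vertexGameProgram,
    11 + ((2 + ((.X * (13 + 2) + 1) + (2 + (.X * (5 + 2) + 1)))) + p), fun ⟨G, hG⟩ => ?_⟩
  obtain ⟨σ, T, hE, hT, hπ⟩ := exists_exec (P := vertexGameArcs) (STGraph.isNetwork_vertexArc hG)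
    (STGraph.isGameOf_vertexPathGame hG) (STGraph.encode_numV (G := G))
    (fun σ hI hS => runs_vertexGameArcs hI hS) rfl rfl
  refine ⟨σ, T, hE, hT.trans ?_, hπ⟩
  have hm : G.numE ≤ G.size := Nat.le_add_left _ _
  have hn : G.numV ≤ G.size := Nat.le_add_right _ _
  simp only [Polynomial.eval_add, Polynomial.eval_mul, Polynomial.eval_X, Polynomial.eval_one,
    Polynomial.eval_ofNat, hp]
  gcongr
  exact disjointPathsTime_mono hn (by gcongr)

end OptCS

theorem mainTheorem11 :
    OptCS.OptCSInPolyTime OptCS.STGraph.encode OptCS.STGraph.size OptCS.STGraph.numE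
        (fun G => G.edgePathGame) ∧
      OptCS.OptCSInPolyTime
        (fun G : {G : OptCS.STGraph // G.NoDirectEdge} => G.1.encode)
        (fun G => G.1.size) (fun G => G.1.numV)
        (fun G => G.1.vertexPathGame G.2) :=
  ⟨OptCS.optCSInPolyTime_edgePathGame, OptCS.optCSInPolyTime_vertexPathGame⟩
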